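/- A square domain is a domain $D$ (open connected set) in the Riemann sphere $\overline{\mathbb C}=\mathbb C\cup\{\infty\}$ with $\infty\in D$ whose complementary components are single points or closed squares with sides parallel to the real or the imaginary axis. Let $\Omega$ be a square domain that is finitely connected, i.e. whose complement $\overline{\mathbb C}\setminus\Omega$ has finitely many (possibly no) connected components. Consider conformal maps (injective holomorphic maps into the sphere) $f\colon\Omega\to D:=f(\Omega)\subseteq\overline{\mathbb C}$ with the normalization $$f(z)=z+\frac{a_1}{z}+\frac{a_2}{z^2}+\cdots\qquad\text{near }\infty .$$ For every such $f$ the complement of $D$ has finitely many components $K_1,\dots,K_n$, and $$\mathcal S(f):=2\pi\,\mathrm{Re}(a_1)+\sum_{j=1}^n\bigl(V_j^2-A_j\bigr)\ \ge\ 0,$$ where $V_j=\max_{w\in K_j}\mathrm{Im}(w)-\min_{w\in K_j}\mathrm{Im}(w)$ is the vertical variation and $A_j$ the Euclidean area (Lebesgue measure) of $K_j$. Equality $\mathcal S(f)=0$ holds if and only if $f$ is the identity on $\Omega$. Moreover, the identity on $\Omega$ is the only conformal map of $\Omega$ with the above normalization onto a square domain. -/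

import Mathlib

open Set Filter Topology

noncomputable section

/-- The coordinate on the Riemann sphere `OnePoint ℂ` around the point `p`: it is `z` if `p` is
finite, and `1/z` (with value `0` at `∞`) if `p = ∞`. The values at the one point outside the
domain of the coordinate are irrelevant. -/
def sphereCoord : OnePoint ℂ → OnePoint ℂ → ℂ
  | none, none => 0
  | none, some z => z⁻¹
  | some _, none => 0
  | some _, some z => z

/-- The inverse of the coordinate around `p`: it is `w ↦ w` if `p` is finite, and `w ↦ 1/w`
(with `0 ↦ ∞`) if `p = ∞`. -/
def sphereParam : OnePoint ℂ → ℂ → OnePoint ℂ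
  | none, w => if w = 0 then OnePoint.infty else ((w⁻¹ : ℂ) : OnePoint ℂ)
  | some _, w => (w : OnePoint ℂ)

/-- A map of the Riemann sphere is holomorphic at `p` if it is continuous at `p` and is analytic
in the coordinates around `p` and `f p`. -/
def SphereHolomorphicAt (f : OnePoint ℂ → OnePoint ℂ) (p : OnePoint ℂ) : Prop :=
  ContinuousAt f p ∧
    AnalyticAt ℂ (fun w => sphereCoord (f p) (f (sphereParam p w))) (sphereCoord p p)

/-- `f` is a conformal map of the open set `Ω` onto its image `f '' Ω`, that is, `f` is
holomorphic on `Ω` as a map into the sphere, and injective on `Ω`. -/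
def IsConformalMapOn (f : OnePoint ℂ → OnePoint ℂ) (Ω : Set (OnePoint ℂ)) : Prop :=
  (∀ p ∈ Ω, SphereHolomorphicAt f p) ∧ InjOn f Ω

/-- The normalization `f(z) = z + a₁/z + a₂/z² + ⋯` near `∞`; the tail `a₂/z² + a₃/z³ + ⋯` is
`g(1/z)/z²` with `g` given by a convergent power series at `0`. -/
def HasNormalizedExpansion (f : OnePoint ℂ → OnePoint ℂ) (a₁ : ℂ) : Prop :=
  ∃ g : ℂ → ℂ, AnalyticAt ℂ g 0 ∧
    ∀ᶠ z : ℂ in cocompact ℂ,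
      f (z : OnePoint ℂ) = ((z + a₁ / z + g z⁻¹ / z ^ 2 : ℂ) : OnePoint ℂ)

/-- The set of complementary components of a subset `D` of the Riemann sphere. -/
def complComponents (D : Set (OnePoint ℂ)) : Set (Set (OnePoint ℂ)) :=
  connectedComponentIn Dᶜ '' Dᶜ

/-- A closed square in `ℂ` with sides parallel to the axes, possibly degenerate (a point). -/
def IsAxisSquare (K : Set (OnePoint ℂ)) : Prop :=
  ∃ x y s : ℝ, 0 ≤ s ∧
    K = (fun z : ℂ => (z : OnePoint ℂ)) '' (Icc x (x + s) ×ℂ Icc y (y + s))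

/-- A square domain: a domain of the Riemann sphere that contains `∞` and whose complementary
components are single points or closed squares with sides parallel to the axes. -/
structure IsSquareDomain (D : Set (OnePoint ℂ)) : Prop where
  isOpen : IsOpen D
  isConnected : IsConnected D
  infty_mem : OnePoint.infty ∈ D
  squares : ∀ K ∈ complComponents D, IsAxisSquare K

/-- The part of `K` in the finite plane. -/
def finitePart (K : Set (OnePoint ℂ)) : Set ℂ :=
  (fun z : ℂ => (z : OnePoint ℂ)) ⁻¹' K

/-- The vertical variation `max Im - min Im` of a nonempty compact subset `K` of `ℂ`. -/
def verticalVariation (K : Set (OnePoint ℂ)) : ℝ :=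
  sSup (Complex.im '' finitePart K) - sInf (Complex.im '' finitePart K)

/-- The Euclidean area (Lebesgue measure) of a compact subset `K` of `ℂ`. -/
def planarArea (K : Set (OnePoint ℂ)) : ℝ :=
  MeasureTheory.volume.real (finitePart K)

/-- `2π Re a₁ + ∑ⱼ (Vⱼ² - Aⱼ)`, where the sum is over the complementary components of `D`. -/
def squareFunctional (a₁ : ℂ) (D : Set (OnePoint ℂ)) : ℝ :=
  2 * Real.pi * a₁.re +
    ∑ᶠ K ∈ complComponents D, (verticalVariation K ^ 2 - planarArea K)

end

/-!
The inequality is proved by the length-area method. Let `Q` run through the complementary squares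
of `Ω`, with side lengths `s_Q`, and let `σ Q` be the corresponding complementary component of
`D = f(Ω)`, with vertical variation `V_Q` and area `A_Q`. Let `B` be the part of `Ω` in a large disc
of radius `R`. Three estimates are combined.

* Area: `f` is injective, so `∫_B |f'|²` is the area of `f(B)`. Together with the components of the
  complement of `D` this set is contained, up to a negligible error, in the ellipse that is the
  image of the disc under `z ↦ z + (a₁ / R²) conj z`. So `∫_B |f'|² + ∑ A_Q ≤ πR² + O(1 / R)`
  (`NormalizedConformal.area_inequality`).
* Length: on a vertical chord of the disc, `Im f` grows by at most the integral of `|f'|` over the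
  part in `Ω` plus the sum of the `V_Q` over the squares that meet the chord. Integration over all
  chords gives `πR² - π Re a₁ - O(1 / R) ≤ ∫_B |f'| + ∑ s_Q V_Q`
  (`NormalizedConformal.length_inequality`).
* Trivially, `|B| + ∑ s_Q² ≤ πR²` (`NormalizedConformal.volume_add_sum_le`).

Hence `∫_B (|f'| - 1)² + ∑ (V_Q - s_Q)² ≤ S(f) + O(1 / R)`, and `R → ∞` gives `S(f) ≥ 0`. If
`S(f) = 0`, then `|f'| = 1` on `Ω`, so `f'` is constant by the maximum principle and `f` is the
identity by its normalization.

The topological input is that the complementary components of `Ω` and of `D` correspond to each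
other bijectively, `f(z)` being close to `σ Q` for `z` close to `Q`
(`NormalizedConformal.exists_componentMap`). The component `σ Q` exists because squares are
surrounded by connected rings in `Ω`. Two squares cannot have the same `σ Q`: the image under `f`
of the boundary `γ` of a slightly larger square separates the two limit sets. This is shown by
continuous logarithms in place of winding numbers. If `T` is a connected set disjoint from `f(γ)`
that contains `f(z₁)` and `f(z₂)`, then `(f - f(z₁)) / (f - f(z₂))` has a continuous logarithm
on `γ`. The quotients `(f(z) - f(ζ)) / (z - ζ)` form a connected family of nowhere vanishing
functions of `z`, so `(z - z₁) / (z - z₂)` has one as well, which is impossible if `γ` separates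
`z₁` from `z₂` (`not_isPreconnected_of_separated`).

For the last assertion, `V² = A` for squares. So the inequality for `f` and for its inverse, whose
coefficient is `-a₁`, forces `Re a₁ = 0` and `S(f) = 0`.
-/

open MeasureTheory

/-! ### Components of compact sets and set-valued maps -/

theorem isClosed_connectedComponentIn {S : Type*} [TopologicalSpace S] {E : Set S}
    (hE : IsClosed E) {p : S} (hp : p ∈ E) : IsClosed (connectedComponentIn E p) := by
  rw [connectedComponentIn_eq_image hp]
  exact hE.isClosedEmbedding_subtypeVal.isClosedMap _ isClosed_connectedComponent

/-- The component of a point of a closed set `E` has arbitrarily small relatively clopen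
neighbourhoods in `E`. -/
theorem exists_isClosed_split {S : Type*} [TopologicalSpace S] [CompactSpace S] [T2Space S]
    {E : Set S} (hE : IsClosed E) {p : S} (hp : p ∈ E) {U : Set S} (hU : IsOpen U)
    (h : connectedComponentIn E p ⊆ U) :
    ∃ A, IsClosed A ∧ IsClosed (E \ A) ∧ p ∈ A ∧ A ⊆ E ∧ A ⊆ U := by
  have : CompactSpace E := isCompact_iff_compactSpace.1 hE.isCompact
  have h1 : connectedComponent (⟨p, hp⟩ : E) ⊆ Subtype.val ⁻¹' U := by
    rw [← image_subset_iff, ← connectedComponentIn_eq_image hp]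
    exact h
  rw [connectedComponent_eq_iInter_isClopen] at h1
  have : Nonempty { s : Set E // IsClopen s ∧ (⟨p, hp⟩ : E) ∈ s } :=
    ⟨⟨univ, isClopen_univ, mem_univ _⟩⟩
  obtain ⟨⟨A, hA, hpA⟩, hAU⟩ := exists_subset_nhds_of_isCompact
    (V := fun s : { s : Set E // IsClopen s ∧ (⟨p, hp⟩ : E) ∈ s } => (s : Set E))
    (by
      intro s t
      exact ⟨⟨s.1 ∩ t.1, s.2.1.inter t.2.1, s.2.2, t.2.2⟩, inter_subset_left, inter_subset_right⟩)
    (fun s => s.2.1.isClosed.isCompact)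
    (fun x hx => (hU.preimage continuous_subtype_val).mem_nhds (h1 hx))
  refine ⟨Subtype.val '' A, hE.isClosedEmbedding_subtypeVal.isClosedMap _ hA.isClosed, ?_,
    ⟨_, hpA, rfl⟩, by rintro _ ⟨x, -, rfl⟩; exact x.2, by
      rintro _ ⟨x, hx, rfl⟩; exact hAU hx⟩
  have : E \ (Subtype.val '' A) = Subtype.val '' Aᶜ := by
    ext x
    constructor
    · rintro ⟨hx, hxA⟩
      exact ⟨⟨x, hx⟩, fun h => hxA ⟨_, h, rfl⟩, rfl⟩
    · rintro ⟨x, hx, rfl⟩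
      refine ⟨x.2, ?_⟩
      rintro ⟨y, hy, hxy⟩
      exact hx (Subtype.ext hxy ▸ hy)
  rw [this]
  exact hE.isClosedEmbedding_subtypeVal.isClosedMap _ hA.compl.isClosed

/-- A map that tends to a closed set `E` along a filter with connected images tends to a single
component of `E`. -/
theorem exists_tendsto_nhdsSet_connectedComponentIn {X S : Type*} [TopologicalSpace S]
    [CompactSpace S] [T2Space S] {E : Set S} (hE : IsClosed E) {l : Filter X} [NeBot l]
    {g : X → S} (hg : Tendsto g l (𝓝ˢ E))
    (hl : ∀ s ∈ l, ∃ t ∈ l, t ⊆ s ∧ IsPreconnected (g '' t)) :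
    ∃ p ∈ E, Tendsto g l (𝓝ˢ (connectedComponentIn E p)) := by
  obtain ⟨p, hp⟩ := exists_clusterPt_of_compactSpace (map g l)
  have hpE : p ∈ E := by
    by_contra hpE
    obtain ⟨U, V, hU, hV, hEU, hpV, hUV⟩ := SeparatedNhds.of_isCompact_isCompact hE.isCompact
      isCompact_singleton (disjoint_singleton_right.2 hpE)
    have h1 : U ∈ map g l := hg (hU.mem_nhdsSet.2 hEU)
    have := (clusterPt_iff_nonempty.1 hp) (hV.mem_nhds (hpV rfl)) h1
    obtain ⟨x, hx⟩ := this
    exact disjoint_left.1 hUV hx.2 hx.1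
  refine ⟨p, hpE, ?_⟩
  rw [(hasBasis_nhdsSet _).tendsto_right_iff]
  rintro U ⟨hU, hKU⟩
  obtain ⟨A, hA, hEA, hpA, hAE, hAU⟩ := exists_isClosed_split hE hpE hU hKU
  obtain ⟨V, W, hV, hW, hAV, hEW, hVW⟩ := SeparatedNhds.of_isCompact_isCompact hA.isCompact
    hEA.isCompact disjoint_sdiff_right
  have h1 : g ⁻¹' ((U ∩ V) ∪ W) ∈ l := hg (((hU.inter hV).union hW).mem_nhdsSet.2 (by
    intro x hx
    by_cases hxA : x ∈ A
    · exact Or.inl ⟨hAU hxA, hAV hxA⟩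
    · exact Or.inr (hEW ⟨hx, hxA⟩)))
  obtain ⟨t, htl, hts, htc⟩ := hl _ h1
  have h2 : (g '' t ∩ (U ∩ V)).Nonempty := by
    have := (clusterPt_iff_nonempty.1 hp) ((hU.inter hV).mem_nhds ⟨hAU hpA, hAV hpA⟩)
      (image_mem_map htl)
    rwa [inter_comm] at this
  have h3 : g '' t ⊆ U ∩ V := by
    refine htc.subset_left_of_subset_union (hU.inter hV) hW (hVW.mono_left inter_subset_right)
      (image_subset_iff.2 hts) h2
  filter_upwards [htl] with x hx
  exact (h3 ⟨x, hx, rfl⟩).1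

/-- The image of a preconnected set under an upper semicontinuous set-valued map with nonempty
preconnected values is preconnected. -/
theorem isPreconnected_biUnion_of_upperSemicontinuous {X S : Type*} [TopologicalSpace X]
    [TopologicalSpace S] {L : Set X} (hL : IsPreconnected L) {F : X → Set S}
    (hF : ∀ x ∈ L, IsConnected (F x))
    (husc : ∀ x ∈ L, ∀ U, IsOpen U → F x ⊆ U → ∀ᶠ y in 𝓝[L] x, F y ⊆ U) :
    IsPreconnected (⋃ x ∈ L, F x) := by
  intro U V hU hV hcov hMU hMV
  by_contra hne
  rw [not_nonempty_iff_eq_empty] at hne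
  have key : ∀ x ∈ L, F x ⊆ U ∨ F x ⊆ V := by
    intro x hx
    have hsub : F x ⊆ ⋃ x ∈ L, F x := subset_biUnion_of_mem hx
    by_contra hcon
    push Not at hcon
    obtain ⟨a, ha, haU⟩ := not_subset.1 hcon.1
    obtain ⟨b, hb, hbV⟩ := not_subset.1 hcon.2
    obtain ⟨c, hc⟩ := (hF x hx).isPreconnected U V hU hV (hsub.trans hcov)
      ⟨b, hb, (hcov (hsub hb)).resolve_right hbV⟩ ⟨a, ha, (hcov (hsub ha)).resolve_left haU⟩
    exact (hne ▸ (⟨hsub hc.1, hc.2⟩ : c ∈ (⋃ x ∈ L, F x) ∩ (U ∩ V)) : c ∈ (∅ : Set S))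
  have hnot : ∀ x ∈ L, ¬ (F x ⊆ U ∧ F x ⊆ V) := by
    rintro x hx ⟨h1, h2⟩
    obtain ⟨c, hc⟩ := (hF x hx).nonempty
    exact (hne ▸ (⟨subset_biUnion_of_mem hx hc, h1 hc, h2 hc⟩ :
      c ∈ (⋃ x ∈ L, F x) ∩ (U ∩ V)) : c ∈ (∅ : Set S))
  obtain ⟨a, ha, haU⟩ := hMU
  obtain ⟨x, hx, hax⟩ := mem_iUnion₂.1 ha
  obtain ⟨b, hb, hbV⟩ := hMV
  obtain ⟨y, hy, hby⟩ := mem_iUnion₂.1 hb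
  have hxU : F x ⊆ U := (key x hx).resolve_right fun h => by
    exact (hne ▸ (⟨ha, haU, h hax⟩ : a ∈ (⋃ x ∈ L, F x) ∩ (U ∩ V)) : a ∈ (∅ : Set S))
  have hyV : F y ⊆ V := (key y hy).resolve_left fun h => by
    exact (hne ▸ (⟨hb, h hby, hbV⟩ : b ∈ (⋃ x ∈ L, F x) ∩ (U ∩ V)) : b ∈ (∅ : Set S))
  have := hL.induction₂ (fun x y => F x ⊆ U ↔ F y ⊆ U) (fun z hz => by
    rcases key z hz with h | h
    · filter_upwards [husc z hz U hU h] with w hw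
      exact ⟨fun _ => hw, fun _ => h⟩
    · filter_upwards [husc z hz V hV h, self_mem_nhdsWithin] with w hw hwL
      exact ⟨fun h' => (hnot z hz ⟨h', h⟩).elim, fun h' => (hnot w hwL ⟨h', hw⟩).elim⟩)
    (fun _ _ _ _ _ _ h1 h2 => h1.trans h2) (fun _ _ _ _ h => h.symm) hx hy
  exact hnot y hy ⟨this.1 hxU, hyV⟩

/-- An injective local homeomorphism on an open set `Ω` of a compact space is proper as a map
onto its image. -/
theorem tendsto_nhdsSet_compl_image {S S' : Type*} [TopologicalSpace S] [CompactSpace S]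
    [T2Space S] [TopologicalSpace S'] [CompactSpace S'] [T2Space S'] {Ω : Set S}
    (hΩ : IsOpen Ω) {f : S → S'} (hf : ∀ p ∈ Ω, map f (𝓝 p) = 𝓝 (f p)) (hinj : InjOn f Ω) :
    Tendsto f (𝓝ˢ Ωᶜ ⊓ 𝓟 Ω) (𝓝ˢ (f '' Ω)ᶜ) := by
  rcases Ω.eq_empty_or_nonempty with rfl | ⟨p₀, -⟩
  · simp
  have : Nonempty S := ⟨p₀⟩
  rw [(hasBasis_nhdsSet _).tendsto_right_iff]
  rintro V ⟨hV, hDV⟩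
  have hVD : Vᶜ ⊆ f '' Ω := compl_subset_comm.1 hDV
  have hcont : ContinuousOn (Function.invFunOn f Ω) Vᶜ := by
    intro w hw
    obtain ⟨p, hp, rfl⟩ := hVD hw
    refine ContinuousAt.continuousWithinAt ?_
    rw [ContinuousAt, hinj.leftInvOn_invFunOn hp, ← hf p hp, tendsto_map'_iff]
    refine Tendsto.congr' ?_ tendsto_id
    filter_upwards [hΩ.mem_nhds hp] with q hq
    exact (hinj.leftInvOn_invFunOn hq).symm
  have hcpt := (hV.isClosed_compl.isCompact.image_of_continuousOn hcont).isClosed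
  rw [eventually_inf_principal]
  have : (Function.invFunOn f Ω '' Vᶜ)ᶜ ∈ 𝓝ˢ Ωᶜ := hcpt.isOpen_compl.mem_nhdsSet.2 (by
    rw [compl_subset_compl]
    rintro _ ⟨w, hw, rfl⟩
    exact Function.invFunOn_mem (hVD hw))
  filter_upwards [this] with p hp hpΩ
  by_contra hpV
  exact hp ⟨f p, hpV, hinj.leftInvOn_invFunOn hpΩ⟩

theorem isOpen_image_of_map_nhds {S S' : Type*} [TopologicalSpace S] [TopologicalSpace S']
    {Ω : Set S} (hΩ : IsOpen Ω) {f : S → S'} (hf : ∀ p ∈ Ω, map f (𝓝 p) = 𝓝 (f p)) :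
    IsOpen (f '' Ω) := by
  rw [isOpen_iff_mem_nhds]
  rintro _ ⟨p, hp, rfl⟩
  rw [← hf p hp]
  exact image_mem_map (hΩ.mem_nhds hp)

/-- Every component of the complement of a nonempty open set of a connected compact space touches
the open set; otherwise it would have a neighbourhood in the complement that is clopen in the whole
space. -/
theorem connectedComponentIn_inter_closure_nonempty {S : Type*} [TopologicalSpace S]
    [CompactSpace S] [T2Space S] [PreconnectedSpace S] {D : Set S} (hD : IsOpen D)
    (hne : D.Nonempty) {p : S} (hp : p ∈ Dᶜ) :
    (connectedComponentIn Dᶜ p ∩ closure D).Nonempty := by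
  by_contra h
  rw [not_nonempty_iff_eq_empty, ← disjoint_iff_inter_eq_empty,
    ← subset_compl_iff_disjoint_right] at h
  obtain ⟨A, hA, hEA, hpA, hAE, hAU⟩ := exists_isClosed_split hD.isClosed_compl hp
    isClosed_closure.isOpen_compl h
  have hopen : IsOpen A := by
    have : A = (Dᶜ \ A)ᶜ ∩ (closure D)ᶜ := by
      ext x
      constructor
      · exact fun hx => ⟨fun h => h.2 hx, hAU hx⟩
      · rintro ⟨h1, h2⟩
        by_contra hxA
        exact h1 ⟨fun hxD => h2 (subset_closure hxD), hxA⟩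
    rw [this]
    exact hEA.isOpen_compl.inter isClosed_closure.isOpen_compl
  obtain ⟨q, hq⟩ := hne
  have : A = univ := IsClopen.eq_univ ⟨hA, hopen⟩ ⟨p, hpA⟩
  exact hAE (this ▸ mem_univ q) hq

/-- If `f` maps neighbourhoods of the finitely many compact sets that make up the complement of
`Ω` close to the components `σ i` of the complement of `f '' Ω`, then these are all the
components. -/
theorem complement_component_mem_range {S S' : Type*} [TopologicalSpace S] [CompactSpace S]
    [T2Space S] [TopologicalSpace S'] [CompactSpace S'] [T2Space S'] [PreconnectedSpace S']
    {Ω : Set S} (hΩ : IsOpen Ω) (hne : Ω.Nonempty) {f : S → S'}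
    (hf : ∀ p ∈ Ω, map f (𝓝 p) = 𝓝 (f p)) {ι : Type*} [Finite ι] {Q : ι → Set S}
    (hQ : ⋃ i, Q i = Ωᶜ) {σ : ι → S'} (hσ : ∀ i, σ i ∈ (f '' Ω)ᶜ)
    (ht : ∀ i, Tendsto f (𝓝ˢ (Q i) ⊓ 𝓟 Ω) (𝓝ˢ (connectedComponentIn (f '' Ω)ᶜ (σ i))))
    {p : S'} (hp : p ∈ (f '' Ω)ᶜ) :
    ∃ i, connectedComponentIn (f '' Ω)ᶜ p = connectedComponentIn (f '' Ω)ᶜ (σ i) := by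
  have hD := isOpen_image_of_map_nhds hΩ hf
  obtain ⟨q, hqK, hqD⟩ := connectedComponentIn_inter_closure_nonempty hD (hne.image f) hp
  have hK : ∀ i, IsClosed (connectedComponentIn (f '' Ω)ᶜ (σ i)) := fun i =>
    isClosed_connectedComponentIn hD.isClosed_compl (hσ i)
  by_contra! hcon
  have hq : q ∉ ⋃ i, connectedComponentIn (f '' Ω)ᶜ (σ i) := by
    rw [mem_iUnion]
    rintro ⟨i, hi⟩
    exact hcon i ((connectedComponentIn_eq hqK).trans (connectedComponentIn_eq hi).symm)
  obtain ⟨U, V, hU, hV, hUK, hqV, hUV⟩ := SeparatedNhds.of_isCompact_isCompact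
    (isClosed_iUnion_of_finite hK).isCompact isCompact_singleton
    (disjoint_singleton_right.2 hq)
  have h1 : ∀ i, ∀ᶠ z in 𝓝ˢ (Q i), z ∈ Ω → f z ∈ U := fun i =>
    eventually_inf_principal.1 (ht i (hU.mem_nhdsSet.2 ((subset_iUnion _ i).trans hUK)))
  have h2 : ∀ᶠ z in 𝓝ˢ Ωᶜ, z ∈ Ω → f z ∈ U := by
    rw [← hQ, eventually_nhdsSet_iUnion]
    exact h1
  obtain ⟨W, hW, hΩW, hWU⟩ := eventually_nhdsSet_iff_exists.1 h2
  have hcpt : IsCompact (f '' Wᶜ) := by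
    refine hW.isClosed_compl.isCompact.image_of_continuousOn fun z hz => ?_
    exact ContinuousAt.continuousWithinAt (hf z (compl_subset_comm.1 hΩW hz)).le
  have hq2 : q ∉ f '' Wᶜ := by
    rintro ⟨z, hz, rfl⟩
    exact connectedComponentIn_subset _ _ hqK ⟨z, compl_subset_comm.1 hΩW hz, rfl⟩
  obtain ⟨w, ⟨hwV, hw⟩, z, hz, rfl⟩ := mem_closure_iff_nhds.1 hqD (V ∩ (f '' Wᶜ)ᶜ)
    (inter_mem (hV.mem_nhds (hqV rfl)) (hcpt.isClosed.isOpen_compl.mem_nhds hq2))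
  by_cases hzW : z ∈ W
  · exact disjoint_left.1 hUV (hWU z hzW hz) hwV
  · exact hw ⟨z, hzW, rfl⟩

/-! ### Connected rings and continuous logarithms -/

/-- Rings about `c` with respect to a norm `N` of the plane are connected: they are the images of
strips under polar coordinates adapted to `N`. -/
theorem isPreconnected_ring {N : ℂ → ℝ} (hN : Continuous N)
    (hhom : ∀ t : ℝ, 0 ≤ t → ∀ z : ℂ, N (t * z) = t * N z) (hpos : ∀ z ≠ 0, 0 < N z) (c : ℂ)
    {I : Set ℝ} (hI : IsPreconnected I) (hI0 : I ⊆ Ioi 0) :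
    IsPreconnected {z | N (z - c) ∈ I} := by
  have hne : ∀ θ : ℝ, 0 < N (Complex.exp (θ * Complex.I)) := fun θ =>
    hpos _ (Complex.exp_ne_zero _)
  have himg : {z | N (z - c) ∈ I} = (fun p : ℝ × ℝ =>
      c + ((p.1 / N (Complex.exp (p.2 * Complex.I)) : ℝ) : ℂ) * Complex.exp (p.2 * Complex.I)) ''
        (I ×ˢ univ) := by
    ext z
    simp only [mem_image, Prod.exists, mem_prod, mem_univ, and_true]
    constructor
    · intro hz
      refine ⟨N (z - c), (z - c).arg, hz, ?_⟩
      have h1 : N (z - c) = ‖z - c‖ * N (Complex.exp ((z - c).arg * Complex.I)) := by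
        rw [← hhom _ (norm_nonneg _), Complex.norm_mul_exp_arg_mul_I]
      rw [h1, mul_div_cancel_right₀ _ (hne _).ne', Complex.norm_mul_exp_arg_mul_I]
      ring
    · rintro ⟨t, θ, ht, rfl⟩
      rw [mem_ofPred_eq, add_sub_cancel_left,
        hhom _ (div_nonneg (le_of_lt (hI0 ht)) (hne _).le), div_mul_cancel₀ _ (hne _).ne']
      exact ht
  rw [himg]
  refine (hI.prod isPreconnected_univ).image _ (Continuous.continuousOn ?_)
  refine continuous_const.add (Continuous.mul ?_ (by fun_prop))
  exact Complex.continuous_ofReal.comp (continuous_fst.div (hN.comp (by fun_prop))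
    fun p => (hne p.2).ne')

/-- The nowhere vanishing function `h` has a continuous logarithm on `γ`. -/
def HasLogOn (h : ℂ → ℂ) (γ : Set ℂ) : Prop :=
  ∃ l : ℂ → ℂ, ContinuousOn l γ ∧ ∀ z ∈ γ, h z = Complex.exp (l z)

theorem HasLogOn.mul {h₁ h₂ : ℂ → ℂ} {γ : Set ℂ} (H₁ : HasLogOn h₁ γ) (H₂ : HasLogOn h₂ γ) :
    HasLogOn (fun z => h₁ z * h₂ z) γ := by
  obtain ⟨l₁, c₁, e₁⟩ := H₁
  obtain ⟨l₂, c₂, e₂⟩ := H₂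
  exact ⟨_, c₁.add c₂, fun z hz => by
    simp only [e₁ z hz, e₂ z hz, ← Complex.exp_add, Pi.add_apply]⟩

theorem HasLogOn.inv {h : ℂ → ℂ} {γ : Set ℂ} (H : HasLogOn h γ) :
    HasLogOn (fun z => (h z)⁻¹) γ := by
  obtain ⟨l, c, e⟩ := H
  exact ⟨_, c.neg, fun z hz => by simp only [e z hz, Pi.neg_apply, Complex.exp_neg]⟩

theorem HasLogOn.congr {h₁ h₂ : ℂ → ℂ} {γ : Set ℂ} (H : HasLogOn h₁ γ)
    (he : ∀ z ∈ γ, h₂ z = h₁ z) : HasLogOn h₂ γ := by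
  obtain ⟨l, c, e⟩ := H
  exact ⟨l, c, fun z hz => by rw [he z hz, e z hz]⟩

theorem hasLogOn_of_norm_sub_one_lt {h : ℂ → ℂ} {γ : Set ℂ} (hc : ContinuousOn h γ)
    (hlt : ∀ z ∈ γ, ‖h z - 1‖ < 1) : HasLogOn h γ := by
  have hslit : ∀ z ∈ γ, h z ∈ Complex.slitPlane := fun z hz =>
    Complex.ball_one_subset_slitPlane (by rw [mem_ball_iff_norm]; exact hlt z hz)
  exact ⟨fun z => Complex.log (h z), hc.clog hslit, fun z hz =>
    (Complex.exp_log (Complex.slitPlane_ne_zero (hslit z hz))).symm⟩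

/-- Along a connected family of nowhere vanishing functions on a compact set, the quotient of any
two members has a continuous logarithm. -/
theorem hasLogOn_div_of_isPreconnected {γ : Set ℂ} (hγ : IsCompact γ) {T : Set ℂ}
    (hT : IsPreconnected T) {Φ : ℂ → ℂ → ℂ}
    (hc : ContinuousOn (fun p : ℂ × ℂ => Φ p.1 p.2) (T ×ˢ γ))
    (hne : ∀ t ∈ T, ∀ z ∈ γ, Φ t z ≠ 0) {a b : ℂ} (ha : a ∈ T) (hb : b ∈ T) :
    HasLogOn (fun z => Φ a z / Φ b z) γ := by
  have hcz : ∀ t ∈ T, ContinuousOn (Φ t) γ := fun t ht =>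
    hc.comp (f := fun z => (t, z)) (by fun_prop) fun z hz => ⟨ht, hz⟩
  refine hT.induction₂ (fun a b => HasLogOn (fun z => Φ a z / Φ b z) γ) (fun x hx => ?_)
    (fun x y z _ hy _ h1 h2 => ?_) (fun x y _ _ h => ?_) ha hb
  · have h1 : ∀ z ∈ γ, ∀ᶠ p : ℂ × ℂ in 𝓝[T] x ×ˢ 𝓝[γ] z, ‖Φ x p.2 / Φ p.1 p.2 - 1‖ < 1 := by
      intro z hz
      have hΦ : Tendsto (fun p : ℂ × ℂ => Φ p.1 p.2) (𝓝[T] x ×ˢ 𝓝[γ] z) (𝓝 (Φ x z)) := by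
        have := hc (x, z) ⟨hx, hz⟩
        rwa [ContinuousWithinAt, nhdsWithin_prod_eq] at this
      have hΦx : Tendsto (fun p : ℂ × ℂ => Φ x p.2) (𝓝[T] x ×ˢ 𝓝[γ] z) (𝓝 (Φ x z)) :=
        (hcz x hx z hz).tendsto.comp tendsto_snd
      have := ((hΦx.div hΦ (hne x hx z hz)).sub_const 1).norm
      rw [div_self (hne x hx z hz), sub_self, norm_zero] at this
      exact this.eventually_lt_const one_pos
    have h2 : ∀ᶠ t in 𝓝[T] x, ∀ z ∈ γ, ‖Φ x z / Φ t z - 1‖ < 1 := by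
      have : {p : ℂ × ℂ | p.2 ∈ γ → ‖Φ x p.2 / Φ p.1 p.2 - 1‖ < 1} ∈ 𝓝[T] x ×ˢ 𝓝ˢ γ := by
        refine hγ.mem_prod_nhdsSet_of_forall fun z hz => ?_
        obtain ⟨t₁, ht₁, t₂, ht₂, hsub⟩ := mem_prod_iff.1 (h1 z hz)
        obtain ⟨u, hu, hut⟩ := mem_nhdsWithin_iff_exists_mem_nhds_inter.1 ht₂
        exact mem_prod_iff.2 ⟨t₁, ht₁, u, hu, fun p hp hpγ => hsub ⟨hp.1, hut ⟨hp.2, hpγ⟩⟩⟩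
      exact (eventually_iff.2 this).curry.mono fun t h z hz => h.self_of_nhdsSet z hz hz
    filter_upwards [h2, self_mem_nhdsWithin] with t ht htT
    exact hasLogOn_of_norm_sub_one_lt ((hcz x hx).div (hcz t htT) (hne t htT)) ht
  · exact (h1.mul h2).congr fun w hw => (div_mul_div_cancel₀ (hne y hy w hw)).symm
  · exact h.inv.congr fun w _ => (inv_div _ _).symm

/-- The identity has no continuous logarithm on a curve that winds around the origin. -/
theorem not_hasLogOn_ring {N : ℂ → ℝ} (hN : Continuous N)
    (hhom : ∀ t : ℝ, 0 ≤ t → ∀ z : ℂ, N (t * z) = t * N z) (hpos : ∀ z ≠ 0, 0 < N z) (c : ℂ)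
    {r : ℝ} (hr : 0 < r) : ¬ HasLogOn (fun z => z - c) {z | N (z - c) = r} := by
  rintro ⟨l, hl, hexp⟩
  have hne : ∀ θ : ℝ, 0 < N (Complex.exp (θ * Complex.I)) := fun θ =>
    hpos _ (Complex.exp_ne_zero _)
  set P : ℝ → ℂ := fun θ =>
    c + ((r / N (Complex.exp (θ * Complex.I)) : ℝ) : ℂ) * Complex.exp (θ * Complex.I) with hP
  have hPmem : ∀ θ, P θ ∈ {z | N (z - c) = r} := by
    intro θ
    rw [mem_ofPred_eq, hP]
    simp only [add_sub_cancel_left]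
    rw [hhom _ (div_nonneg hr.le (hne _).le), div_mul_cancel₀ _ (hne _).ne']
  have hPc : Continuous P := by
    refine continuous_const.add (Continuous.mul ?_ (by fun_prop))
    exact Complex.continuous_ofReal.comp (continuous_const.div (hN.comp (by fun_prop))
      fun p => (hne p).ne')
  set m : ℝ → ℂ := fun θ => l (P θ) - θ * Complex.I with hm
  have hmc : Continuous m := by
    have : Continuous fun θ => l (P θ) := by
      rw [← continuousOn_univ]
      exact hl.comp hPc.continuousOn fun θ _ => hPmem θ
    exact this.sub (by fun_prop)
  have hcos : ∀ θ, 0 < Real.cos (m θ).im := by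
    intro θ
    have h1 : Complex.exp (m θ) = ((r / N (Complex.exp (θ * Complex.I)) : ℝ) : ℂ) := by
      rw [hm, Complex.exp_sub, ← hexp _ (hPmem θ), hP]
      simp only [add_sub_cancel_left]
      rw [mul_div_cancel_right₀ _ (Complex.exp_ne_zero _)]
    have h2 := congrArg Complex.re h1
    rw [Complex.exp_re, Complex.ofReal_re] at h2
    have h3 : 0 < r / N (Complex.exp (θ * Complex.I)) := div_pos hr (hne _)
    rw [← h2] at h3
    exact pos_of_mul_pos_right h3 (Real.exp_pos _).le
  have hP0 : P (2 * Real.pi) = P 0 := by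
    simp [hP, Complex.exp_two_pi_mul_I]
  have hm0 : (m (2 * Real.pi)).im = (m 0).im - 2 * Real.pi := by
    simp [hm, hP0]
  -- `Im m` decreases by `2π`, so somewhere it is decreased by `π`, where its cosine is negative
  obtain ⟨θ, -, hθ⟩ := intermediate_value_Icc' (f := fun θ => (m θ).im)
    (by positivity : (0 : ℝ) ≤ 2 * Real.pi) (Complex.continuous_im.comp hmc).continuousOn
    (show (m 0).im - Real.pi ∈ _ by
      simp only [hm0]
      constructor <;> linarith [Real.pi_pos])
  have h1 := hcos θ
  simp only at hθ
  rw [hθ, Real.cos_sub_pi] at h1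
  linarith [hcos 0]

/-! ### Injective holomorphic maps -/

theorem AnalyticAt.map_nhds_eq_of_injOn {F : ℂ → ℂ} {z : ℂ} (hF : AnalyticAt ℂ F z) {U : Set ℂ}
    (hU : U ∈ 𝓝 z) (hinj : InjOn F U) : map F (𝓝 z) = 𝓝 (F z) := by
  refine le_antisymm hF.continuousAt
    (hF.eventually_constant_or_nhds_le_map_nhds.resolve_left fun h => ?_)
  have : ∀ᶠ w in 𝓝[≠] z, False := by
    filter_upwards [nhdsWithin_le_nhds h, nhdsWithin_le_nhds hU, self_mem_nhdsWithin]
      with w h1 h2 h3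
    exact h3 (hinj h2 (mem_of_mem_nhds hU) h1)
  exact this.exists.choose_spec

/-- A left inverse of an injective holomorphic map is holomorphic on the image. It is
continuous by the open mapping theorem and has a derivative off the image of the discrete zero
set of the derivative, so the singularities are removable. -/
theorem analyticAt_of_leftInvOn {F G : ℂ → ℂ} {U : Set ℂ} (hU : IsOpen U)
    (hF : ∀ z ∈ U, AnalyticAt ℂ F z) (hinj : InjOn F U) (hG : ∀ z ∈ U, G (F z) = z) {z : ℂ}
    (hz : z ∈ U) : AnalyticAt ℂ G (F z) := by
  have hcont : ∀ z ∈ U, ContinuousAt G (F z) := by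
    intro z hz
    rw [ContinuousAt, hG z hz, ← (hF z hz).map_nhds_eq_of_injOn (hU.mem_nhds hz) hinj,
      tendsto_map'_iff]
    refine tendsto_id.congr' ?_
    filter_upwards [hU.mem_nhds hz] with w hw using (hG w hw).symm
  refine Complex.analyticAt_of_differentiable_on_punctured_nhds_of_continuousAt ?_ (hcont z hz)
  have hmap := (hF z hz).map_nhds_eq_of_injOn (hU.mem_nhds hz) hinj
  -- if `F'` vanished near `z`, then `F` would be constant there
  have hd : ∀ᶠ w in 𝓝[≠] z, deriv F w ≠ 0 := by
    refine (hF z hz).deriv.eventually_eq_zero_or_eventually_ne_zero.resolve_left fun h => ?_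
    obtain ⟨ε, hε, hball⟩ := Metric.eventually_nhds_iff_ball.1
      (h.and (hU.eventually_mem hz))
    obtain ⟨w, hw, hwz⟩ : ∃ w ∈ Metric.ball z ε, w ≠ z := by
      refine ⟨z + (ε / 2 : ℝ), ?_, ?_⟩
      · rw [Metric.mem_ball, dist_eq_norm, add_sub_cancel_left, Complex.norm_real,
          Real.norm_of_nonneg (by positivity)]
        linarith
      · simp [hε.ne']
    have hconst := (convex_ball z ε).is_const_of_fderivWithin_eq_zero (𝕜 := ℂ) (f := F)
      (fun x hx => (hF x (hball x hx).2).differentiableAt.differentiableWithinAt)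
      (fun x hx => by
        rw [fderivWithin_of_isOpen Metric.isOpen_ball hx]
        ext
        simpa using (hball x hx).1) hw (Metric.mem_ball_self hε)
    exact hwz (hinj (hball w hw).2 hz hconst)
  have hd' : ∀ᶠ w in 𝓝 z, w ≠ z → DifferentiableAt ℂ G (F w) := by
    filter_upwards [eventually_nhdsWithin_iff.1 hd, hU.mem_nhds hz] with w h1 h2 h3
    refine (HasDerivAt.of_local_left_inverse (f := F) (f' := deriv F w) (hcont w h2) ?_ (h1 h3)
      ?_).differentiableAt
    · rw [hG w h2]
      exact (hF w h2).differentiableAt.hasDerivAt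
    · rw [← (hF w h2).map_nhds_eq_of_injOn (hU.mem_nhds h2) hinj, eventually_map]
      filter_upwards [hU.mem_nhds h2] with x hx
      rw [hG x hx]
  rw [eventually_nhdsWithin_iff, ← hmap, eventually_map]
  filter_upwards [hd'] with w hw hne
  exact hw fun h => hne (by simp [h])

theorem deriv_ne_zero_of_injOn {F : ℂ → ℂ} {U : Set ℂ} (hU : IsOpen U)
    (hF : ∀ z ∈ U, AnalyticAt ℂ F z) (hinj : InjOn F U) {z : ℂ} (hz : z ∈ U) :
    deriv F z ≠ 0 := by
  have hG : ∀ z ∈ U, Function.invFunOn F U (F z) = z := fun z hz => hinj.leftInvOn_invFunOn hz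
  have h1 := (analyticAt_of_leftInvOn hU hF hinj hG hz).differentiableAt.hasDerivAt
  have h2 := h1.comp z (hF z hz).differentiableAt.hasDerivAt
  have h3 : HasDerivAt (Function.invFunOn F U ∘ F) 1 z := by
    refine (hasDerivAt_id z).congr_of_eventuallyEq ?_
    filter_upwards [hU.mem_nhds hz] with w hw using hG w hw
  intro h
  have := h2.unique h3
  simp [h] at this

/-! ### Normalized conformal maps -/

/-- The data of a normalized conformal map `f` of the open connected set `Ω ∋ ∞`, with `F` the
expression of `f` in the finite plane: `f` is an injective local homeomorphism that fixes `∞`, is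
holomorphic at the finite points, and satisfies `F z = z + a / z + O(1 / z²)` at `∞`. Unlike the
normalization by a power series, these properties pass to the inverse map without effort. -/
structure NormalizedConformal (Ω : Set (OnePoint ℂ)) (f : OnePoint ℂ → OnePoint ℂ) (F : ℂ → ℂ)
    (a : ℂ) : Prop where
  isOpen : IsOpen Ω
  isPreconnected : IsPreconnected Ω
  infty_mem : OnePoint.infty ∈ Ω
  map_infty : f OnePoint.infty = OnePoint.infty
  map_nhds : ∀ p ∈ Ω, map f (𝓝 p) = 𝓝 (f p)
  injOn : InjOn f Ω
  coe_eq : ∀ z : ℂ, (z : OnePoint ℂ) ∈ Ω → f z = (F z : OnePoint ℂ)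
  analyticAt : ∀ z : ℂ, (z : OnePoint ℂ) ∈ Ω → AnalyticAt ℂ F z
  asymp : ∃ C r : ℝ, ∀ z : ℂ, r ≤ ‖z‖ → ‖F z - z - a / z‖ ≤ C / ‖z‖ ^ 2

theorem isOpen_finitePart {Ω : Set (OnePoint ℂ)} (h : IsOpen Ω) : IsOpen (finitePart Ω) :=
  h.preimage OnePoint.continuous_coe

theorem coe_image_finitePart {K : Set (OnePoint ℂ)} (h : OnePoint.infty ∉ K) :
    (fun z : ℂ => (z : OnePoint ℂ)) '' finitePart K = K := by
  rw [finitePart, image_preimage_eq_iff]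
  intro p hp
  exact OnePoint.ne_infty_iff_exists.1 fun h' => h (h' ▸ hp)

theorem exists_norm_le_mem_finitePart {Ω : Set (OnePoint ℂ)} (h : Ω ∈ 𝓝 OnePoint.infty) :
    ∃ r : ℝ, 0 < r ∧ ∀ z : ℂ, r ≤ ‖z‖ → z ∈ finitePart Ω := by
  have : ∀ᶠ z : ℂ in cocompact ℂ, (z : OnePoint ℂ) ∈ Ω := by
    have := OnePoint.tendsto_coe_infty (X := ℂ)
    rw [coclosedCompact_eq_cocompact] at this
    exact this h
  rw [← Metric.cobounded_eq_cocompact, ← comap_norm_atTop] at this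
  obtain ⟨r, hr⟩ := mem_atTop_sets.1 (mem_comap.1 this).choose_spec.1
  refine ⟨max r 1, by positivity, fun z hz => ?_⟩
  exact (mem_comap.1 this).choose_spec.2 (hr _ ((le_max_left _ _).trans hz))

theorem isPreconnected_compl_closedBall (r : ℝ) (hr : 0 ≤ r) :
    IsPreconnected {z : ℂ | r < ‖z‖} := by
  have := isPreconnected_ring (N := fun z => ‖z‖) continuous_norm
    (fun t ht z => by simp [abs_of_nonneg ht]) (fun z hz => norm_pos_iff.2 hz) 0
    (isPreconnected_Ioi (a := r)) (Ioi_subset_Ioi hr)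
  simpa using this

/-- Removing `∞` does not disconnect an open set. -/
theorem isPreconnected_finitePart {Ω : Set (OnePoint ℂ)} (hΩ : IsOpen Ω)
    (hc : IsPreconnected Ω) (h : OnePoint.infty ∈ Ω) : IsPreconnected (finitePart Ω) := by
  obtain ⟨r, hr, hrΩ⟩ := exists_norm_le_mem_finitePart (hΩ.mem_nhds h)
  have hring := isPreconnected_compl_closedBall r hr.le
  have hringU : {z : ℂ | r < ‖z‖} ⊆ finitePart Ω := fun z hz => hrΩ z (le_of_lt hz)
  have hopen : ∀ V : Set ℂ, IsOpen V → {z : ℂ | r < ‖z‖} ⊆ V →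
      IsOpen ((fun z : ℂ => (z : OnePoint ℂ)) '' V ∪ {OnePoint.infty}) := by
    intro V hV hrV
    rw [OnePoint.isOpen_iff_of_mem (by simp)]
    have : ((↑) : ℂ → OnePoint ℂ) ⁻¹'
        ((fun z : ℂ => (z : OnePoint ℂ)) '' V ∪ {OnePoint.infty}) = V := by
      ext z; simp
    rw [this]
    refine ⟨hV.isClosed_compl, ?_⟩
    refine (isCompact_closedBall (0 : ℂ) r).of_isClosed_subset hV.isClosed_compl fun z hz => ?_
    rw [mem_closedBall_zero_iff]
    by_contra! h
    exact hz (hrV h)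
  have main : ∀ V W : Set ℂ, IsOpen V → IsOpen W → V ∩ W = ∅ →
      finitePart Ω = V ∪ W → W.Nonempty → ¬ {z : ℂ | r < ‖z‖} ⊆ V := by
    intro V W hV hW hVW hΩVW hWne hrV
    have hinf : Ω ⊆ ((fun z : ℂ => (z : OnePoint ℂ)) '' V ∪ {OnePoint.infty}) ∪
        ((fun z : ℂ => (z : OnePoint ℂ)) '' W) := by
      intro p hp
      induction p using OnePoint.rec with
      | infty => simp
      | coe z =>
        rcases hΩVW.subset (show z ∈ finitePart Ω from hp) with h | h
        · exact Or.inl (Or.inl ⟨z, h, rfl⟩)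
        · exact Or.inr ⟨z, h, rfl⟩
    obtain ⟨w, hw⟩ := hWne
    obtain ⟨p, -, hp1, hp2⟩ := hc _ _ (hopen V hV hrV) (OnePoint.isOpen_image_coe.2 hW) hinf
      ⟨_, h, Or.inr rfl⟩ ⟨w, hΩVW.superset (Or.inr hw), w, hw, rfl⟩
    obtain ⟨w', hw', rfl⟩ := hp2
    rcases hp1 with ⟨v, hv, hvw⟩ | hp1
    · rw [OnePoint.coe_eq_coe.1 hvw] at hv
      exact (hVW ▸ (⟨hv, hw'⟩ : w' ∈ V ∩ W) : w' ∈ (∅ : Set ℂ))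
    · exact OnePoint.coe_ne_infty _ hp1
  intro V W hV hW hcov hVne hWne
  have hU := isOpen_finitePart hΩ
  by_contra hemp
  rw [not_nonempty_iff_eq_empty] at hemp
  have hcov' : finitePart Ω = (finitePart Ω ∩ V) ∪ (finitePart Ω ∩ W) := by
    rw [← inter_union_distrib_left, inter_eq_self_of_subset_left hcov]
  have hdis : (finitePart Ω ∩ V) ∩ (finitePart Ω ∩ W) = ∅ := by
    rw [← inter_inter_distrib_left, hemp]
  rcases hring.subset_or_subset (hU.inter hV) (hU.inter hW)
    (disjoint_iff_inter_eq_empty.2 hdis) (hringU.trans hcov'.subset) with h1 | h1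
  · exact main _ _ (hU.inter hV) (hU.inter hW) hdis hcov' hWne h1
  · exact main _ _ (hU.inter hW) (hU.inter hV) (by rw [inter_comm]; exact hdis)
      (by rw [union_comm]; exact hcov') hVne h1

theorem map_sphereParam_infty : map (sphereParam OnePoint.infty) (𝓝 0) = 𝓝 OnePoint.infty := by
  have h0 : sphereParam OnePoint.infty 0 = OnePoint.infty := by
    show (if (0 : ℂ) = 0 then _ else _) = _
    simp
  have h1 : ∀ w : ℂ, w ≠ 0 → sphereParam OnePoint.infty w = ((w⁻¹ : ℂ) : OnePoint ℂ) := by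
    intro w hw
    show (if w = 0 then _ else _) = _
    simp [hw]
  rw [OnePoint.nhds_infty_eq, ← pure_sup_nhdsNE, map_sup, map_pure, h0, sup_comm,
    coclosedCompact_eq_cocompact, ← Metric.cobounded_eq_cocompact, ← Filter.inv_nhdsNE_zero]
  congr 1
  rw [← Filter.map_inv, Filter.map_map]
  exact Filter.map_congr (by
    filter_upwards [self_mem_nhdsWithin] with w hw using h1 w hw)

theorem sphereParam_sphereCoord_infty {q : OnePoint ℂ} (hq : q ≠ ((0 : ℂ) : OnePoint ℂ)) :
    sphereParam OnePoint.infty (sphereCoord OnePoint.infty q) = q := by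
  induction q using OnePoint.rec with
  | infty =>
    show (if (0 : ℂ) = 0 then _ else _) = _
    simp
  | coe z =>
    have hz : z ≠ 0 := fun h => hq (by rw [h])
    show (if z⁻¹ = 0 then OnePoint.infty else (((z⁻¹)⁻¹ : ℂ) : OnePoint ℂ)) = _
    simp [hz]

theorem HasNormalizedExpansion.exists_asymp {f : OnePoint ℂ → OnePoint ℂ} {a : ℂ}
    (h : HasNormalizedExpansion f a) :
    ∃ C r : ℝ, ∀ z : ℂ, r ≤ ‖z‖ → ∃ w : ℂ, f z = w ∧ ‖w - z - a / z‖ ≤ C / ‖z‖ ^ 2 := by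
  obtain ⟨g, hg, hf⟩ := h
  have hb : ∀ᶠ t in 𝓝 (0 : ℂ), ‖g t‖ < ‖g 0‖ + 1 :=
    hg.continuousAt.norm.eventually_lt_const (lt_add_one _)
  have hb' : ∀ᶠ z in cocompact ℂ, ‖g z⁻¹‖ < ‖g 0‖ + 1 := by
    rw [← Metric.cobounded_eq_cocompact]
    exact Filter.tendsto_inv₀_cobounded.eventually hb
  have := hf.and hb'
  rw [← Metric.cobounded_eq_cocompact, ← comap_norm_atTop] at this
  obtain ⟨s, hs, hsub⟩ := mem_comap.1 this
  obtain ⟨r, hr⟩ := mem_atTop_sets.1 hs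
  refine ⟨‖g 0‖ + 1, r, fun z hz => ?_⟩
  obtain ⟨h1, h2⟩ := hsub (hr _ hz)
  refine ⟨_, h1, ?_⟩
  rw [show z + a / z + g z⁻¹ / z ^ 2 - z - a / z = g z⁻¹ / z ^ 2 by ring, norm_div, norm_pow]
  gcongr

theorem exists_norm_sub_le_of_asymp {F : ℂ → ℂ} {a : ℂ} {C r : ℝ}
    (h : ∀ z : ℂ, r ≤ ‖z‖ → ‖F z - z - a / z‖ ≤ C / ‖z‖ ^ 2) :
    ∃ B : ℝ, 0 ≤ B ∧ ∀ z : ℂ, max r 1 ≤ ‖z‖ → ‖F z - z‖ ≤ B / ‖z‖ := by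
  refine ⟨‖a‖ + |C|, by positivity, fun z hz => ?_⟩
  have h1 := h z ((le_max_left _ _).trans hz)
  have hz1 : 1 ≤ ‖z‖ := (le_max_right _ _).trans hz
  calc ‖F z - z‖ = ‖(F z - z - a / z) + a / z‖ := by ring_nf
    _ ≤ ‖F z - z - a / z‖ + ‖a / z‖ := norm_add_le _ _
    _ ≤ |C| / ‖z‖ + ‖a‖ / ‖z‖ := by
        rw [norm_div]
        gcongr
        refine h1.trans ?_
        calc C / ‖z‖ ^ 2 ≤ |C| / ‖z‖ ^ 2 := by gcongr; exact le_abs_self _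
          _ ≤ |C| / ‖z‖ := by
            apply div_le_div_of_nonneg_left (abs_nonneg _) (by linarith)
            nlinarith
    _ = (‖a‖ + |C|) / ‖z‖ := by ring

/-- A conformal map with a normalized power series expansion at `∞` is a normalized conformal map
in the sense of `NormalizedConformal`. -/
theorem NormalizedConformal.exists_of_isConformalMapOn {Ω : Set (OnePoint ℂ)} (hΩ : IsOpen Ω)
    (hc : IsPreconnected Ω) (h : OnePoint.infty ∈ Ω) {f : OnePoint ℂ → OnePoint ℂ} {a : ℂ}
    (hf : IsConformalMapOn f Ω) (ha : HasNormalizedExpansion f a) :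
    ∃ F, NormalizedConformal Ω f F a := by
  obtain ⟨C, r, hCr⟩ := ha.exists_asymp
  set F : ℂ → ℂ := fun z => (f z).elim 0 id with hFdef
  have hasymp : ∀ z : ℂ, r ≤ ‖z‖ → ‖F z - z - a / z‖ ≤ C / ‖z‖ ^ 2 := by
    intro z hz
    obtain ⟨w, h1, h2⟩ := hCr z hz
    rw [hFdef]
    simp only [h1]
    exact h2
  have hlarge : ∀ z : ℂ, r ≤ ‖z‖ → f z = (F z : OnePoint ℂ) := by
    intro z hz
    obtain ⟨w, h1, h2⟩ := hCr z hz
    rw [hFdef]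
    simp only [h1]
    rfl
  have hFinf : Tendsto F (cocompact ℂ) (cocompact ℂ) := by
    obtain ⟨B, hB, hBF⟩ := exists_norm_sub_le_of_asymp hasymp
    rw [← Metric.cobounded_eq_cocompact, ← tendsto_norm_atTop_iff_cobounded]
    have h1 : Tendsto (fun z : ℂ => ‖z‖ - B) (Bornology.cobounded ℂ) atTop :=
      tendsto_atTop_add_const_right _ _ tendsto_norm_cobounded_atTop
    refine tendsto_atTop_mono' _ ?_ h1
    filter_upwards [tendsto_norm_cobounded_atTop.eventually (eventually_ge_atTop (max r 1))]
      with z hz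
    have h2 := hBF z hz
    have hz1 : 1 ≤ ‖z‖ := (le_max_right _ _).trans hz
    have h3 : B / ‖z‖ ≤ B := div_le_self hB hz1
    have h4 := norm_sub_norm_le z (F z)
    rw [norm_sub_rev] at h4
    linarith
  have hev : ∀ᶠ z in cocompact ℂ, r ≤ ‖z‖ := by
    rw [← Metric.cobounded_eq_cocompact]
    exact tendsto_norm_cobounded_atTop.eventually (eventually_ge_atTop r)
  have hcoe : Tendsto ((↑) : ℂ → OnePoint ℂ) (cocompact ℂ) (𝓝 OnePoint.infty) := by
    have := OnePoint.tendsto_coe_infty (X := ℂ)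
    rwa [coclosedCompact_eq_cocompact] at this
  have hinf : f OnePoint.infty = OnePoint.infty := by
    have h1 : Tendsto (fun z : ℂ => f z) (cocompact ℂ) (𝓝 (f OnePoint.infty)) :=
      (hf.1 _ h).1.tendsto.comp hcoe
    have h2 : Tendsto (fun z : ℂ => f z) (cocompact ℂ) (𝓝 OnePoint.infty) := by
      refine (hcoe.comp hFinf).congr' ?_
      filter_upwards [hev] with z hz using (hlarge z hz).symm
    exact tendsto_nhds_unique h1 h2
  have hfin : ∀ z : ℂ, (z : OnePoint ℂ) ∈ Ω → f z = (F z : OnePoint ℂ) := by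
    intro z hz
    have : f z ≠ OnePoint.infty := fun h' =>
      OnePoint.coe_ne_infty z (hf.2 hz h (h'.trans hinf.symm))
    obtain ⟨w, hw⟩ := OnePoint.ne_infty_iff_exists.1 this
    rw [hFdef]
    simp only [← hw]
    rfl
  have han : ∀ z : ℂ, (z : OnePoint ℂ) ∈ Ω → AnalyticAt ℂ F z := by
    intro z hz
    have h1 := (hf.1 _ hz).2
    refine h1.congr ?_
    filter_upwards [(isOpen_finitePart hΩ).mem_nhds hz] with w hw
    rw [hfin z hz]
    show sphereCoord (F z) (f w) = F w
    rw [hfin w hw]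
    rfl
  have hUo := isOpen_finitePart hΩ
  have hFinj : InjOn F (finitePart Ω) := by
    intro z hz w hw hzw
    refine OnePoint.coe_injective (hf.2 hz hw ?_)
    rw [hfin z hz, hfin w hw, hzw]
  refine ⟨F, hΩ, hc, h, hinf, fun p hp => ?_, hf.2, hfin, han, C, r, hasymp⟩
  induction p using OnePoint.rec with
  | coe z =>
    rw [hfin z hp, OnePoint.nhds_coe_eq, OnePoint.nhds_coe_eq, Filter.map_map,
      ← (han z hp).map_nhds_eq_of_injOn (hUo.mem_nhds hp) hFinj, Filter.map_map]
    refine Filter.map_congr ?_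
    filter_upwards [hUo.mem_nhds hp] with w hw using hfin w hw
  | infty =>
    set φ : ℂ → ℂ := fun w => sphereCoord OnePoint.infty (f (sphereParam OnePoint.infty w))
      with hφ
    have hp0 : sphereParam OnePoint.infty 0 = OnePoint.infty := by
      show (if (0 : ℂ) = 0 then _ else _) = _
      simp
    have hφan : AnalyticAt ℂ φ 0 := by
      have := (hf.1 _ h).2
      rwa [hinf] at this
    have hφ0 : φ 0 = 0 := by
      rw [hφ]
      simp only [hp0, hinf]
      rfl
    have hparam : Tendsto (sphereParam OnePoint.infty) (𝓝 0) (𝓝 OnePoint.infty) :=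
      map_sphereParam_infty.le
    have hfpar : Tendsto (fun w => f (sphereParam OnePoint.infty w)) (𝓝 0) (𝓝 OnePoint.infty) := by
      have := (hf.1 _ h).1.tendsto
      rw [hinf] at this
      exact this.comp hparam
    have hcoord : ∀ᶠ w in 𝓝 (0 : ℂ),
        sphereParam OnePoint.infty (φ w) = f (sphereParam OnePoint.infty w) := by
      have : ({((0 : ℂ) : OnePoint ℂ)}ᶜ : Set (OnePoint ℂ)) ∈ 𝓝 OnePoint.infty :=
        isOpen_compl_singleton.mem_nhds (by simp)
      filter_upwards [hfpar this] with w hw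
      exact sphereParam_sphereCoord_infty hw
    have hmapφ : map φ (𝓝 0) = 𝓝 0 := by
      have hs := hcoord.and (hparam (hΩ.mem_nhds h))
      have := hφan.map_nhds_eq_of_injOn hs (fun x hx y hy hxy => by
        have h1 : f (sphereParam OnePoint.infty x) = f (sphereParam OnePoint.infty y) := by
          rw [← hx.1, ← hy.1, hxy]
        have h2 := hf.2 hx.2 hy.2 h1
        have hparinj : Function.Injective (sphereParam OnePoint.infty) := by
          refine Function.LeftInverse.injective (g := sphereCoord OnePoint.infty) fun w => ?_
          by_cases hw : w = 0
          · rw [hw, hp0]; rfl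
          · have : sphereParam OnePoint.infty w = ((w⁻¹ : ℂ) : OnePoint ℂ) := by
              show (if w = 0 then _ else _) = _
              simp [hw]
            rw [this]
            show (w⁻¹)⁻¹ = w
            simp
        exact hparinj h2)
      rwa [hφ0] at this
    calc map f (𝓝 OnePoint.infty)
        = map (fun w => f (sphereParam OnePoint.infty w)) (𝓝 0) := by
          rw [← map_sphereParam_infty, Filter.map_map]; rfl
      _ = map (fun w => sphereParam OnePoint.infty (φ w)) (𝓝 0) :=
          (Filter.map_congr hcoord).symm
      _ = map (sphereParam OnePoint.infty) (map φ (𝓝 0)) := by rw [Filter.map_map]; rfl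
      _ = 𝓝 (f OnePoint.infty) := by rw [hmapφ, map_sphereParam_infty, hinf]

namespace NormalizedConformal

variable {Ω : Set (OnePoint ℂ)} {f : OnePoint ℂ → OnePoint ℂ} {F : ℂ → ℂ} {a : ℂ}

theorem injOn_finitePart (H : NormalizedConformal Ω f F a) : InjOn F (finitePart Ω) := by
  intro z hz w hw hzw
  refine OnePoint.coe_injective (H.injOn hz hw ?_)
  rw [H.coe_eq z hz, H.coe_eq w hw, hzw]

/-- All points near `∞` are images of points near `∞`. -/
theorem exists_eq_of_norm_ge (H : NormalizedConformal Ω f F a) (r : ℝ) :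
    ∃ ρ : ℝ, 0 < ρ ∧ ∀ w : ℂ, ρ ≤ ‖w‖ → ∃ z ∈ finitePart Ω, r < ‖z‖ ∧ F z = w := by
  have hnear : f '' {p | p ∈ Ω ∧ ∀ z : ℂ, p = z → r < ‖z‖} ∈ 𝓝 OnePoint.infty := by
    rw [← H.map_infty, ← H.map_nhds _ H.infty_mem]
    refine image_mem_map (inter_mem (H.isOpen.mem_nhds H.infty_mem) ?_)
    have : IsCompact ((fun z : ℂ => (z : OnePoint ℂ)) '' Metric.closedBall 0 r) :=
      (isCompact_closedBall _ _).image OnePoint.continuous_coe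
    filter_upwards [this.isClosed.isOpen_compl.mem_nhds
      (x := OnePoint.infty) (by simp)] with p hp z hpz
    by_contra! hcon
    exact hp ⟨z, mem_closedBall_zero_iff.2 hcon, hpz.symm⟩
  obtain ⟨ρ, hρ, hρD⟩ := exists_norm_le_mem_finitePart hnear
  refine ⟨ρ, hρ, fun w hw => ?_⟩
  obtain ⟨p, ⟨hp, hpr⟩, hpw⟩ := hρD w hw
  induction p using OnePoint.rec with
  | infty => rw [H.map_infty] at hpw; exact (OnePoint.infty_ne_coe _ hpw).elim
  | coe z =>
    exact ⟨z, hp, hpr z rfl, OnePoint.coe_injective ((H.coe_eq z hp).symm.trans hpw)⟩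

/-- The inverse of a normalized conformal map is normalized, with the opposite coefficient. -/
theorem symm (H : NormalizedConformal Ω f F a) :
    ∃ G, NormalizedConformal (f '' Ω) (Function.invFunOn f Ω) G (-a) := by
  set g := Function.invFunOn f Ω with hg
  have hgf : ∀ p ∈ Ω, g (f p) = p := fun p hp => H.injOn.leftInvOn_invFunOn hp
  set G : ℂ → ℂ := fun w => (g w).elim 0 id with hG
  have hGF : ∀ z ∈ finitePart Ω, G (F z) = z := by
    intro z hz
    rw [hG]
    simp only [← H.coe_eq z hz, hgf _ hz]
    rfl
  have hD := isOpen_image_of_map_nhds H.isOpen H.map_nhds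
  have hinfD : OnePoint.infty ∈ f '' Ω := ⟨_, H.infty_mem, H.map_infty⟩
  have hmap : ∀ q ∈ f '' Ω, map g (𝓝 q) = 𝓝 (g q) := by
    rintro _ ⟨p, hp, rfl⟩
    rw [hgf p hp, ← H.map_nhds p hp, Filter.map_map]
    refine (Filter.map_congr ?_).trans Filter.map_id
    filter_upwards [H.isOpen.mem_nhds hp] with q hq using hgf q hq
  have hfinite : ∀ w : ℂ, (w : OnePoint ℂ) ∈ f '' Ω → ∃ z ∈ finitePart Ω, F z = w := by
    rintro w ⟨p, hp, hpw⟩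
    induction p using OnePoint.rec with
    | infty => rw [H.map_infty] at hpw; exact (OnePoint.infty_ne_coe _ hpw).elim
    | coe z => exact ⟨z, hp, OnePoint.coe_injective ((H.coe_eq z hp).symm.trans hpw)⟩
  refine ⟨G, hD, H.isPreconnected.image _ fun p hp =>
    ContinuousAt.continuousWithinAt (H.map_nhds p hp).le, hinfD, ?_, hmap, ?_, ?_, ?_, ?_⟩
  · have := hgf _ H.infty_mem
    rwa [H.map_infty] at this
  · rintro _ ⟨p, hp, rfl⟩ _ ⟨q, hq, rfl⟩ hpq
    rw [hgf p hp, hgf q hq] at hpq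
    rw [hpq]
  · intro w hw
    obtain ⟨z, hz, rfl⟩ := hfinite w hw
    rw [hGF z hz, ← H.coe_eq z hz, hgf _ hz]
  · intro w hw
    obtain ⟨z, hz, rfl⟩ := hfinite w hw
    exact analyticAt_of_leftInvOn (isOpen_finitePart H.isOpen) H.analyticAt H.injOn_finitePart
      hGF hz
  · obtain ⟨C, r, hCr⟩ := H.asymp
    obtain ⟨B, hB, hBF⟩ := exists_norm_sub_le_of_asymp hCr
    obtain ⟨ρ, hρ, hρz⟩ := H.exists_eq_of_norm_ge (max r (1 + B))
    refine ⟨4 * (|C| + ‖a‖ * B), max ρ 1, fun w hw => ?_⟩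
    obtain ⟨z, hp, hzr, rfl⟩ := hρz w ((le_max_left _ _).trans hw)
    have hw1 : 1 ≤ ‖F z‖ := (le_max_right _ _).trans hw
    have hzr1 : r ≤ ‖z‖ := (le_max_left _ _).trans hzr.le
    have hz1 : 1 + B ≤ ‖z‖ := (le_max_right _ _).trans hzr.le
    have hz0 : 0 < ‖z‖ := by linarith
    have h1 := hCr z hzr1
    have h2 := hBF z (max_le hzr1 (by linarith))
    have h3 : ‖F z‖ ≤ 2 * ‖z‖ := by
      have h4 := norm_sub_norm_le (F z) z
      have h5 : B / ‖z‖ ≤ B := div_le_self hB (by linarith)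
      linarith
    have hzne : z ≠ 0 := norm_pos_iff.1 hz0
    have hwne : F z ≠ 0 := norm_pos_iff.1 (by linarith)
    rw [hGF z hp]
    have h6 : z - F z - -a / F z = -(F z - z - a / z) + a * ((z - F z) / (z * F z)) := by
      field_simp
      ring
    rw [h6]
    have h7 : ‖F z‖ / 2 ≤ ‖z‖ := by linarith
    have hw0 : 0 < ‖F z‖ := by linarith
    calc ‖-(F z - z - a / z) + a * ((z - F z) / (z * F z))‖
        ≤ ‖F z - z - a / z‖ + ‖a‖ * (‖F z - z‖ / (‖z‖ * ‖F z‖)) := by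
          refine (norm_add_le _ _).trans ?_
          rw [norm_neg, norm_mul, norm_div, norm_mul, norm_sub_rev z (F z)]
      _ ≤ |C| / ‖z‖ ^ 2 + ‖a‖ * (B / ‖z‖ / (‖z‖ * 1)) := by
          gcongr
          exact h1.trans (by gcongr; exact le_abs_self _)
      _ = (|C| + ‖a‖ * B) / ‖z‖ ^ 2 := by field_simp
      _ ≤ (|C| + ‖a‖ * B) / (‖F z‖ / 2) ^ 2 := by gcongr
      _ = 4 * (|C| + ‖a‖ * B) / ‖F z‖ ^ 2 := by field_simp; ring

end NormalizedConformal

/-! ### Conformal maps separate the complementary components -/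

/-- Difference quotients of a holomorphic function are jointly continuous, on the diagonal by
strict differentiability. -/
theorem continuousOn_dslope_prod {U : Set ℂ} {F : ℂ → ℂ}
    (hF : ∀ z ∈ U, AnalyticAt ℂ F z) :
    ContinuousOn (fun p : ℂ × ℂ => dslope F p.1 p.2) (U ×ˢ U) := by
  rintro ⟨x, y⟩ ⟨hx, hy⟩
  simp only at hx hy
  refine ContinuousAt.continuousWithinAt ?_
  by_cases hxy : x = y
  · subst hxy
    rw [Metric.continuousAt_iff']
    intro ε hε
    simp only [dslope_same]
    have h1 : ∀ᶠ p : ℂ × ℂ in 𝓝 (x, x),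
        ‖F p.2 - F p.1 - deriv F x * (p.2 - p.1)‖ ≤ ε / 2 * ‖p.2 - p.1‖ := by
      have h := (hF x hx).hasStrictDerivAt.hasStrictFDerivAt.isLittleO.def (half_pos hε)
      have h' := (continuous_swap.tendsto (x, x)).eventually h
      filter_upwards [h'] with p hp
      simpa [mul_comm] using hp
    have h2 : ∀ᶠ p : ℂ × ℂ in 𝓝 (x, x), dist (deriv F p.1) (deriv F x) < ε :=
      (continuous_fst.tendsto (x, x)).eventually
        (Metric.continuousAt_iff'.1 (hF x hx).deriv.continuousAt ε hε)
    filter_upwards [h1, h2] with p hp1 hp2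
    by_cases hp : p.2 = p.1
    · rw [hp, dslope_same]
      exact hp2
    · have hp' : p.2 - p.1 ≠ 0 := sub_ne_zero.2 hp
      rw [dslope_of_ne _ hp, slope_def_field, dist_eq_norm]
      have h3 : (F p.2 - F p.1) / (p.2 - p.1) - deriv F x =
          (F p.2 - F p.1 - deriv F x * (p.2 - p.1)) / (p.2 - p.1) := by
        field_simp
      rw [h3, norm_div]
      have := norm_pos_iff.2 hp'
      refine ((div_le_iff₀ this).2 hp1).trans_lt (half_lt_self hε)
  · have hev : ∀ᶠ p : ℂ × ℂ in 𝓝 (x, y), p.2 ≠ p.1 :=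
      (isOpen_ne_fun continuous_snd continuous_fst).mem_nhds (Ne.symm hxy)
    have h1 : ContinuousAt (fun p : ℂ × ℂ => (F p.2 - F p.1) / (p.2 - p.1)) (x, y) := by
      have h2 : ContinuousAt (fun p : ℂ × ℂ => F p.2) (x, y) :=
        (hF y hy).continuousAt.comp (f := fun p : ℂ × ℂ => p.2) continuousAt_snd
      have h3 : ContinuousAt (fun p : ℂ × ℂ => F p.1) (x, y) :=
        (hF x hx).continuousAt.comp (f := fun p : ℂ × ℂ => p.1) continuousAt_fst
      exact (h2.sub h3).div (by fun_prop) (sub_ne_zero.2 (Ne.symm hxy))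
    refine h1.congr ?_
    filter_upwards [hev] with p hp
    rw [dslope_of_ne _ hp, slope_def_field]

theorem dslope_ne_zero_of_injOn {U : Set ℂ} (hU : IsOpen U) {F : ℂ → ℂ}
    (hF : ∀ z ∈ U, AnalyticAt ℂ F z) (hinj : InjOn F U) {x y : ℂ} (hx : x ∈ U) (hy : y ∈ U) :
    dslope F x y ≠ 0 := by
  by_cases hxy : y = x
  · rw [hxy, dslope_same]
    exact deriv_ne_zero_of_injOn hU hF hinj hx
  · rw [dslope_of_ne _ hxy, slope_def_field]
    exact div_ne_zero (sub_ne_zero.2 fun h => hxy (hinj hy hx h)) (sub_ne_zero.2 hxy)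

/-- The supremum norm of the plane `ℂ = ℝ²`; its balls are the squares with sides parallel to the
axes. -/
def supNorm (z : ℂ) : ℝ := max |z.re| |z.im|

theorem continuous_supNorm : Continuous supNorm :=
  (Complex.continuous_re.abs).max (Complex.continuous_im.abs)

theorem supNorm_smul (t : ℝ) (ht : 0 ≤ t) (z : ℂ) : supNorm (t * z) = t * supNorm z := by
  simp [supNorm, abs_mul, abs_of_nonneg ht, mul_max_of_nonneg _ _ ht]

theorem supNorm_pos (z : ℂ) (hz : z ≠ 0) : 0 < supNorm z := by
  by_contra! h
  have h1 : |z.re| ≤ 0 := (le_max_left _ _).trans h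
  have h2 : |z.im| ≤ 0 := (le_max_right _ _).trans h
  exact hz (Complex.ext (abs_nonpos_iff.1 h1) (abs_nonpos_iff.1 h2))

theorem norm_le_two_mul_supNorm (z : ℂ) : ‖z‖ ≤ 2 * supNorm z := by
  have h1 : |z.re| ≤ supNorm z := le_max_left _ _
  have h2 : |z.im| ≤ supNorm z := le_max_right _ _
  linarith [Complex.norm_le_abs_re_add_abs_im z]

theorem isCompact_supNorm_le (c : ℂ) (r : ℝ) : IsCompact {z | supNorm (z - c) ≤ r} := by
  refine (isCompact_closedBall c (2 * r)).of_isClosed_subset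
    (isClosed_le (continuous_supNorm.comp (by fun_prop)) continuous_const) fun z hz => ?_
  rw [mem_closedBall_iff_norm]
  exact (norm_le_two_mul_supNorm _).trans (by have : supNorm (z - c) ≤ r := hz; linarith)

theorem convex_supNorm_lt (c : ℂ) (r : ℝ) : Convex ℝ {z | supNorm (z - c) < r} := by
  have : {z | supNorm (z - c) < r} = Metric.ball c.re r ×ℂ Metric.ball c.im r := by
    ext z
    simp [supNorm, Complex.mem_reProdIm, Real.dist_eq]
  rw [this]
  exact ((convex_ball _ _).is_linear_preimage Complex.reLm.isLinear).inter
    ((convex_ball _ _).is_linear_preimage Complex.imLm.isLinear)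

/-- A connected set that avoids the image of the boundary of a square under an injective
holomorphic map cannot contain images of a point inside and a point outside of the square.
Otherwise, as all functions involved move in connected families, `z - z₁` would have the same
winding number as `z - z₂` along the boundary of the square. -/
theorem not_isPreconnected_of_separated {U : Set ℂ} (hU : IsOpen U) (hUc : IsPreconnected U)
    {F : ℂ → ℂ} (hF : ∀ z ∈ U, AnalyticAt ℂ F z) (hinj : InjOn F U) {c : ℂ} {r : ℝ} (hr : 0 < r)
    (hγU : {z | supNorm (z - c) = r} ⊆ U) {z₁ z₂ : ℂ} (h₁ : z₁ ∈ U) (h₂ : z₂ ∈ U)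
    (hz₁ : supNorm (z₁ - c) < r) (hz₂ : r < supNorm (z₂ - c)) {T : Set ℂ}
    (hT : Disjoint T (F '' {z | supNorm (z - c) = r})) (h₁T : F z₁ ∈ T) (h₂T : F z₂ ∈ T) :
    ¬ IsPreconnected T := by
  intro hTc
  set γ := {z | supNorm (z - c) = r} with hγdef
  have hγ : IsCompact γ := (isCompact_supNorm_le c r).of_isClosed_subset
    (isClosed_eq (continuous_supNorm.comp (by fun_prop)) continuous_const) fun z hz => le_of_eq hz
  have hFc : ContinuousOn F U := fun z hz => (hF z hz).continuousAt.continuousWithinAt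
  have hsub : Continuous (fun p : ℂ × ℂ => p.2 - p.1) := by fun_prop
  -- move the base value from `F z₁` to `F z₂` within `T`
  have hlogF : HasLogOn (fun z => (F z - F z₁) / (F z - F z₂)) γ := by
    refine hasLogOn_div_of_isPreconnected (Φ := fun w z => F z - w) hγ hTc ?_ ?_ h₁T h₂T
    · refine ContinuousOn.sub ?_ continuousOn_fst
      exact hFc.comp continuousOn_snd fun p hp => hγU hp.2
    · intro t ht z hz h
      exact disjoint_left.1 hT ht ⟨z, hz, sub_eq_zero.1 h⟩
  -- move the base point of the difference quotient from `z₁` to `z₂` within `U`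
  have hlogS : HasLogOn (fun z => dslope F z₁ z / dslope F z₂ z) γ :=
    hasLogOn_div_of_isPreconnected (Φ := fun x z => dslope F x z) hγ hUc
      ((continuousOn_dslope_prod hF).mono (prod_mono_right hγU))
      (fun x hx z hz => dslope_ne_zero_of_injOn hU hF hinj hx (hγU hz)) h₁ h₂
  -- move `z₁` to the centre inside of the square
  have hlogIn : HasLogOn (fun z => (z - c) / (z - z₁)) γ := by
    refine hasLogOn_div_of_isPreconnected (Φ := fun x z => z - x) hγ
      (convex_supNorm_lt c r).isPreconnected hsub.continuousOn ?_ ?_ hz₁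
    · intro t ht z hz h
      rw [← sub_eq_zero.1 h] at ht
      exact ht.ne hz
    · simpa [supNorm] using hr
  obtain ⟨ρ, hρ⟩ := (hγ.isBounded.union (isCompact_supNorm_le c r).isBounded).exists_norm_le
  set w : ℂ := ((|ρ| + 1 : ℝ) : ℂ) with hw
  have hwn : ‖w‖ = |ρ| + 1 := by
    rw [hw, Complex.norm_real, Real.norm_of_nonneg (by positivity)]
  have hw0 : w ≠ 0 := by rw [← norm_pos_iff, hwn]; positivity
  have hwout : r < supNorm (w - c) := by
    by_contra! hcon
    have := hρ w (Or.inr hcon)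
    rw [hwn] at this
    linarith [le_abs_self ρ]
  -- move `z₂` to the far away point `w` outside of the square
  have hlogOut : HasLogOn (fun z => (z - z₂) / (z - w)) γ := by
    refine hasLogOn_div_of_isPreconnected (Φ := fun x z => z - x) hγ
      (isPreconnected_ring continuous_supNorm supNorm_smul supNorm_pos c
        (isPreconnected_Ioi (a := r)) (Ioi_subset_Ioi hr.le)) hsub.continuousOn ?_ hz₂ hwout
    intro t ht z hz h
    rw [← sub_eq_zero.1 h] at ht
    exact (ne_of_gt ht) hz
  -- `z - w = -w * (1 - z / w)` with `|z / w| < 1`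
  have hlogw : HasLogOn (fun z => z - w) γ := by
    have h3 : HasLogOn (fun z => 1 - z / w) γ := by
      refine hasLogOn_of_norm_sub_one_lt (by fun_prop) fun z hz => ?_
      rw [sub_sub_cancel_left, norm_neg, norm_div, hwn, div_lt_one (by positivity)]
      linarith [hρ z (Or.inl hz), le_abs_self ρ]
    have h4 : HasLogOn (fun _ => -w) γ :=
      ⟨fun _ => Complex.log (-w), continuousOn_const, fun _ _ =>
        (Complex.exp_log (neg_ne_zero.2 hw0)).symm⟩
    refine (h4.mul h3).congr fun z _ => ?_
    field_simp
    ring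
  refine not_hasLogOn_ring continuous_supNorm supNorm_smul supNorm_pos c hr
    (((hlogIn.mul hlogF).mul (hlogS.inv.mul (hlogOut.mul hlogw))).congr fun z hz => ?_)
  have e1 : z - z₁ ≠ 0 := fun h => by
    rw [← sub_eq_zero.1 h] at hz₁; exact hz₁.ne hz
  have e2 : z - z₂ ≠ 0 := fun h => by
    rw [← sub_eq_zero.1 h] at hz₂; exact hz₂.ne' hz
  have e3 : z - w ≠ 0 := fun h => by
    rw [← sub_eq_zero.1 h] at hwout; exact hwout.ne' hz
  have s1 : F z - F z₁ = (z - z₁) * dslope F z₁ z := (sub_smul_dslope F z₁ z).symm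
  have s2 : F z - F z₂ = (z - z₂) * dslope F z₂ z := (sub_smul_dslope F z₂ z).symm
  have d1 := dslope_ne_zero_of_injOn hU hF hinj h₁ (hγU hz)
  have d2 := dslope_ne_zero_of_injOn hU hF hinj h₂ (hγU hz)
  simp only [s1, s2]
  field_simp

/-! ### Squares and the correspondence of complementary components -/

theorem IsAxisSquare.exists_finitePart_eq {K : Set (OnePoint ℂ)} (h : IsAxisSquare K) :
    ∃ (c : ℂ) (s : ℝ), 0 ≤ s ∧ finitePart K = {z | supNorm (z - c) ≤ s} ∧
      OnePoint.infty ∉ K := by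
  obtain ⟨x, y, s, hs, rfl⟩ := h
  refine ⟨⟨x + s / 2, y + s / 2⟩, s / 2, by positivity, ?_, OnePoint.infty_notMem_image_coe⟩
  rw [finitePart, preimage_image_eq _ OnePoint.coe_injective]
  ext z
  simp only [Complex.mem_reProdIm, mem_Icc, mem_ofPred_eq, supNorm, Complex.sub_re,
    Complex.sub_im, max_le_iff, abs_le]
  constructor
  · rintro ⟨⟨h1, h2⟩, h3, h4⟩
    refine ⟨⟨?_, ?_⟩, ?_, ?_⟩ <;> linarith
  · rintro ⟨⟨h1, h2⟩, h3, h4⟩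
    refine ⟨⟨?_, ?_⟩, ?_, ?_⟩ <;> linarith

theorem exists_supNorm_lt_subset {c : ℂ} {s : ℝ} {V : Set ℂ}
    (hV : V ∈ 𝓝ˢ {z | supNorm (z - c) ≤ s}) : ∃ ε > 0, {z | supNorm (z - c) < s + ε} ⊆ V := by
  obtain ⟨W, hW, hsW, hWV⟩ := mem_nhdsSet_iff_exists.1 hV
  have hcont : Continuous fun z => supNorm (z - c) := continuous_supNorm.comp (by fun_prop)
  have hK : IsCompact ({z | supNorm (z - c) ≤ s + 1} \ W) := (isCompact_supNorm_le c _).diff hW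
  rcases ({z | supNorm (z - c) ≤ s + 1} \ W).eq_empty_or_nonempty with h | h
  · refine ⟨1, one_pos, fun z hz => hWV ?_⟩
    exact sdiff_eq_empty.1 h (show supNorm (z - c) ≤ s + 1 from le_of_lt hz)
  · obtain ⟨m, hm, hmin⟩ := hK.exists_isMinOn h hcont.continuousOn
    have hms : s < supNorm (m - c) := by
      by_contra! hcon
      exact hm.2 (hsW hcon)
    have hm1 : supNorm (m - c) ≤ s + 1 := hm.1
    refine ⟨supNorm (m - c) - s, by linarith, fun z hz => hWV ?_⟩
    by_contra hzW
    have hz' : supNorm (z - c) < supNorm (m - c) := by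
      have : supNorm (z - c) < s + (supNorm (m - c) - s) := hz
      linarith
    have h2 : supNorm (m - c) ≤ supNorm (z - c) :=
      hmin ⟨show supNorm (z - c) ≤ s + 1 by linarith, hzW⟩
    linarith

theorem mem_nhdsSet_supNorm_le {c : ℂ} {s ε : ℝ} (hε : 0 < ε) :
    {z | supNorm (z - c) < s + ε} ∈ 𝓝ˢ {z | supNorm (z - c) ≤ s} := by
  have hcont : Continuous fun z => supNorm (z - c) := continuous_supNorm.comp (by fun_prop)
  refine (isOpen_lt hcont continuous_const).mem_nhdsSet.2 fun z hz => ?_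
  exact lt_of_le_of_lt (show supNorm (z - c) ≤ s from hz) (by linarith)

theorem exists_supNorm_sub_eq (c : ℂ) {s : ℝ} (hs : 0 ≤ s) : ∃ z, supNorm (z - c) = s :=
  ⟨c + s, by simp [supNorm, abs_of_nonneg hs, hs]⟩

section complComponents

variable {D : Set (OnePoint ℂ)}

theorem complComponents_subset {K : Set (OnePoint ℂ)} (hK : K ∈ complComponents D) : K ⊆ Dᶜ := by
  obtain ⟨p, -, rfl⟩ := hK
  exact connectedComponentIn_subset _ _

theorem complComponents_isClosed (hD : IsOpen D) {K : Set (OnePoint ℂ)}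
    (hK : K ∈ complComponents D) : IsClosed K := by
  obtain ⟨p, hp, rfl⟩ := hK
  exact isClosed_connectedComponentIn hD.isClosed_compl hp

theorem complComponents_isConnected {K : Set (OnePoint ℂ)} (hK : K ∈ complComponents D) :
    IsConnected K := by
  obtain ⟨p, hp, rfl⟩ := hK
  exact isConnected_connectedComponentIn_iff.2 hp

theorem complComponents_eq_of_mem {K L : Set (OnePoint ℂ)} (hK : K ∈ complComponents D)
    (hL : L ∈ complComponents D) {p : OnePoint ℂ} (hpK : p ∈ K) (hpL : p ∈ L) : K = L := by
  obtain ⟨x, -, rfl⟩ := hK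
  obtain ⟨y, -, rfl⟩ := hL
  exact (connectedComponentIn_eq hpK).trans (connectedComponentIn_eq hpL).symm

theorem sUnion_complComponents : ⋃₀ complComponents D = Dᶜ := by
  refine subset_antisymm (sUnion_subset fun K hK => complComponents_subset hK) fun p hp => ?_
  exact ⟨_, ⟨p, hp, rfl⟩, mem_connectedComponentIn hp⟩

theorem isCompact_finitePart {K : Set (OnePoint ℂ)} (hK : IsClosed K)
    (hinf : OnePoint.infty ∉ K) : IsCompact (finitePart K) :=
  ((OnePoint.isClosed_iff_of_notMem hinf).1 hK).2

theorem complComponents_infty_notMem (h : OnePoint.infty ∈ D) {K : Set (OnePoint ℂ)}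
    (hK : K ∈ complComponents D) : OnePoint.infty ∉ K := fun h' => complComponents_subset hK h' h

theorem isConnected_finitePart_of_mem (h : OnePoint.infty ∈ D) {K : Set (OnePoint ℂ)}
    (hK : K ∈ complComponents D) : IsConnected (finitePart K) := by
  have hinf := complComponents_infty_notMem h hK
  have h1 := complComponents_isConnected hK
  rw [← coe_image_finitePart hinf] at h1
  have hind := OnePoint.isOpenEmbedding_coe (X := ℂ) |>.isInducing
  exact ⟨h1.nonempty.of_image, hind.isPreconnected_image.1 h1.isPreconnected⟩

end complComponents

theorem eventually_mem_of_finite_complComponents {Ω : Set (OnePoint ℂ)} (hΩ : IsOpen Ω)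
    (hfin : (complComponents Ω).Finite) {Q : Set (OnePoint ℂ)} (hQ : Q ∈ complComponents Ω) :
    ∀ᶠ z in 𝓝ˢ (finitePart Q), z ∉ finitePart Ω → z ∈ finitePart Q := by
  have hcl : IsClosed (⋃₀ (complComponents Ω \ {Q})) :=
    (hfin.subset sdiff_subset).isCompact_sUnion (fun K hK =>
      (complComponents_isClosed hΩ hK.1).isCompact) |>.isClosed
  have hV : finitePart (⋃₀ (complComponents Ω \ {Q}))ᶜ ∈ 𝓝ˢ (finitePart Q) := by
    refine (isOpen_finitePart hcl.isOpen_compl).mem_nhdsSet.2 fun z hz => ?_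
    rintro ⟨K, ⟨hK, hKQ⟩, hzK⟩
    exact hKQ (complComponents_eq_of_mem hK hQ hzK hz)
  filter_upwards [hV] with z hzV hz
  have hz' : (z : OnePoint ℂ) ∈ ⋃₀ complComponents Ω := by
    rw [sUnion_complComponents]; exact hz
  obtain ⟨K, hK, hzK⟩ := hz'
  by_contra hzQ
  refine hzV ⟨K, ⟨hK, ?_⟩, hzK⟩
  rintro rfl
  exact hzQ hzK

/-- A complementary square of a square domain is surrounded by rings in the domain. -/
theorem exists_ring_subset {Ω : Set (OnePoint ℂ)} (hΩ : IsOpen Ω)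
    (hfin : (complComponents Ω).Finite) {Q : Set (OnePoint ℂ)} (hQ : Q ∈ complComponents Ω)
    {c : ℂ} {s : ℝ} (hQs : finitePart Q = {z | supNorm (z - c) ≤ s}) :
    ∃ ε > 0, ∀ z, s < supNorm (z - c) → supNorm (z - c) < s + ε → z ∈ finitePart Ω := by
  have h := eventually_mem_of_finite_complComponents hΩ hfin hQ
  rw [hQs] at h
  obtain ⟨ε, hε, hsub⟩ := exists_supNorm_lt_subset h
  refine ⟨ε, hε, fun z h1 h2 => ?_⟩
  by_contra hz
  exact (not_le.2 h1) (hsub h2 hz)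

namespace NormalizedConformal

variable {Ω : Set (OnePoint ℂ)} {f : OnePoint ℂ → OnePoint ℂ} {F : ℂ → ℂ} {a : ℂ}

theorem isOpen_image (H : NormalizedConformal Ω f F a) : IsOpen (f '' Ω) :=
  isOpen_image_of_map_nhds H.isOpen H.map_nhds

theorem infty_mem_image (H : NormalizedConformal Ω f F a) : OnePoint.infty ∈ f '' Ω :=
  ⟨_, H.infty_mem, H.map_infty⟩

/-- Close to a complementary square `Q` of `Ω`, the values of `f` are close to a single component
of the complement of `f '' Ω`. -/
theorem exists_tendsto_component (H : NormalizedConformal Ω f F a)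
    (hfin : (complComponents Ω).Finite) {Q : Set (OnePoint ℂ)} (hQ : Q ∈ complComponents Ω)
    (hQs : IsAxisSquare Q) :
    ∃ p ∈ (f '' Ω)ᶜ, Tendsto f (𝓝ˢ Q ⊓ 𝓟 Ω) (𝓝ˢ (connectedComponentIn (f '' Ω)ᶜ p)) := by
  obtain ⟨c, s, hs, hQc, hinf⟩ := hQs.exists_finitePart_eq
  obtain ⟨ε, hε, hring⟩ := exists_ring_subset H.isOpen hfin hQ hQc
  have hmap : 𝓝ˢ Q = map ((↑) : ℂ → OnePoint ℂ) (𝓝ˢ {z | supNorm (z - c) ≤ s}) := by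
    rw [← hQc]
    conv_lhs => rw [← coe_image_finitePart hinf]
    refine le_antisymm (fun V hV => ?_) ?_
    · obtain ⟨W, hW, hQW, hWV⟩ := mem_nhdsSet_iff_exists.1 (mem_map.1 hV)
      refine mem_of_superset ((OnePoint.isOpen_image_coe.2 hW).mem_nhdsSet.2
        (image_mono hQW)) ?_
      exact image_subset_iff.2 hWV
    · exact OnePoint.continuous_coe.tendsto_nhdsSet (mapsTo_image _ _)
  -- the images of the points of `Ω` near `Q` fill connected rings
  have hbasis : ∀ V ∈ 𝓝ˢ Q ⊓ 𝓟 Ω, ∃ δ, 0 < δ ∧ δ ≤ ε ∧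
      (fun z : ℂ => (z : OnePoint ℂ)) '' {z | supNorm (z - c) ∈ Ioo s (s + δ)} ⊆ V ∧
      (fun z : ℂ => (z : OnePoint ℂ)) '' {z | supNorm (z - c) ∈ Ioo s (s + δ)} ∈
        𝓝ˢ Q ⊓ 𝓟 Ω := by
    intro V hV
    rw [mem_inf_principal, hmap] at hV
    obtain ⟨δ, hδ, hsub⟩ := exists_supNorm_lt_subset (mem_map.1 hV)
    refine ⟨min δ ε, lt_min hδ hε, min_le_right _ _, ?_, ?_⟩
    · rintro _ ⟨z, ⟨h1, h2⟩, rfl⟩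
      refine hsub (lt_of_lt_of_le h2 (by gcongr; exact min_le_left _ _)) ?_
      exact hring z h1 (lt_of_lt_of_le h2 (by gcongr; exact min_le_right _ _))
    · rw [mem_inf_principal, hmap, mem_map]
      refine mem_of_superset (mem_nhdsSet_supNorm_le (lt_min hδ hε)) fun z hz hzΩ => ?_
      refine ⟨z, ⟨?_, hz⟩, rfl⟩
      by_contra! hcon
      have : z ∈ finitePart Q := by rw [hQc]; exact hcon
      exact complComponents_subset hQ this hzΩ
  have hne : NeBot (𝓝ˢ Q ⊓ 𝓟 Ω) := by
    rw [Filter.neBot_iff]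
    intro hbot
    obtain ⟨δ, hδ, -, hsub, -⟩ := hbasis ∅ (hbot ▸ mem_bot)
    obtain ⟨z, hz⟩ := exists_supNorm_sub_eq c (s := s + δ / 2) (by linarith)
    exact hsub ⟨z, ⟨by rw [hz]; linarith, by rw [hz]; linarith⟩, rfl⟩
  refine exists_tendsto_nhdsSet_connectedComponentIn H.isOpen_image.isClosed_compl
    ((tendsto_nhdsSet_compl_image H.isOpen H.map_nhds H.injOn).mono_left
      (inf_le_inf_right _ (nhdsSet_mono (complComponents_subset hQ)))) fun V hV => ?_
  obtain ⟨δ, hδ, hδε, hsub, hmem⟩ := hbasis V hV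
  refine ⟨_, hmem, hsub, ?_⟩
  refine ((isPreconnected_ring continuous_supNorm supNorm_smul supNorm_pos c
    (isPreconnected_Ioo (a := s) (b := s + δ))
    (Ioo_subset_Ioi_self.trans (Ioi_subset_Ioi hs))).image _
      OnePoint.continuous_coe.continuousOn).image _ ?_
  rintro _ ⟨z, ⟨h1, h2⟩, rfl⟩
  exact ContinuousAt.continuousWithinAt
    (H.map_nhds _ (hring z h1 (lt_of_lt_of_le h2 (by gcongr)))).le

end NormalizedConformal

namespace NormalizedConformal

variable {Ω : Set (OnePoint ℂ)} {f : OnePoint ℂ → OnePoint ℂ} {F : ℂ → ℂ} {a : ℂ}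

theorem tendsto_finitePart (H : NormalizedConformal Ω f F a) {Q K : Set (OnePoint ℂ)}
    (hK : OnePoint.infty ∉ K) (h : Tendsto f (𝓝ˢ Q ⊓ 𝓟 Ω) (𝓝ˢ K)) :
    Tendsto F (𝓝ˢ (finitePart Q) ⊓ 𝓟 (finitePart Ω)) (𝓝ˢ (finitePart K)) := by
  have h1 : Tendsto ((↑) : ℂ → OnePoint ℂ) (𝓝ˢ (finitePart Q) ⊓ 𝓟 (finitePart Ω))
      (𝓝ˢ Q ⊓ 𝓟 Ω) :=
    (OnePoint.continuous_coe.tendsto_nhdsSet (mapsTo_preimage _ _)).inf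
      (tendsto_principal_principal.2 fun z hz => hz)
  rw [(hasBasis_nhdsSet _).tendsto_right_iff]
  rintro V ⟨hV, hKV⟩
  have h2 : (fun z : ℂ => (z : OnePoint ℂ)) '' V ∈ 𝓝ˢ K := by
    refine (OnePoint.isOpen_image_coe.2 hV).mem_nhdsSet.2 ?_
    rw [← coe_image_finitePart hK]
    exact image_mono hKV
  filter_upwards [h.comp h1 h2, mem_inf_of_right (mem_principal_self _)] with z hz hzU
  obtain ⟨w, hw, hwz⟩ := hz
  simp only [Function.comp] at hwz
  rw [H.coe_eq z hzU, OnePoint.coe_eq_coe] at hwz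
  rwa [← hwz]

theorem F_mem_image (H : NormalizedConformal Ω f F a) {z : ℂ} (hz : z ∈ finitePart Ω) :
    F z ∈ finitePart (f '' Ω) := ⟨z, hz, H.coe_eq z hz⟩

/-- A normalized conformal map of a square domain of finite connectivity induces a bijection of
the complementary components. -/
theorem exists_componentMap (H : NormalizedConformal Ω f F a)
    (hsq : ∀ Q ∈ complComponents Ω, IsAxisSquare Q) (hfin : (complComponents Ω).Finite) :
    ∃ σ : Set (OnePoint ℂ) → Set (OnePoint ℂ),
      BijOn σ (complComponents Ω) (complComponents (f '' Ω)) ∧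
      ∀ Q ∈ complComponents Ω, Tendsto F (𝓝ˢ (finitePart Q) ⊓ 𝓟 (finitePart Ω))
        (𝓝ˢ (finitePart (σ Q))) := by
  have hex := fun Q : complComponents Ω => H.exists_tendsto_component hfin Q.2 (hsq Q Q.2)
  choose p hp ht using hex
  classical
  set σ : Set (OnePoint ℂ) → Set (OnePoint ℂ) := fun Q =>
    if h : Q ∈ complComponents Ω then connectedComponentIn (f '' Ω)ᶜ (p ⟨Q, h⟩) else ∅ with hσ
  have hσQ : ∀ (Q) (h : Q ∈ complComponents Ω),
      σ Q = connectedComponentIn (f '' Ω)ᶜ (p ⟨Q, h⟩) := fun Q h => dif_pos h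
  have hmaps : MapsTo σ (complComponents Ω) (complComponents (f '' Ω)) := fun Q hQ =>
    ⟨p ⟨Q, hQ⟩, hp _, (hσQ Q hQ).symm⟩
  have hlim : ∀ Q ∈ complComponents Ω, Tendsto F (𝓝ˢ (finitePart Q) ⊓ 𝓟 (finitePart Ω))
        (𝓝ˢ (finitePart (σ Q))) := by
    intro Q hQ
    refine H.tendsto_finitePart (complComponents_infty_notMem H.infty_mem_image (hmaps hQ)) ?_
    rw [hσQ Q hQ]
    exact ht ⟨Q, hQ⟩
  refine ⟨σ, ⟨hmaps, ?_, ?_⟩, hlim⟩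
  · intro Q₁ hQ₁ Q₂ hQ₂ heq
    by_contra hne
    obtain ⟨c, s, hs, hQc, hinf⟩ := (hsq Q₁ hQ₁).exists_finitePart_eq
    obtain ⟨ε, hε, hring⟩ := exists_ring_subset H.isOpen hfin hQ₁ hQc
    set r := s + ε / 2 with hr
    have hγU : {z | supNorm (z - c) = r} ⊆ finitePart Ω := by
      intro z hz
      have hz' : supNorm (z - c) = r := hz
      exact hring z (by rw [hz', hr]; linarith) (by rw [hz', hr]; linarith)
    have hγ : IsCompact {z | supNorm (z - c) = r} :=
      (isCompact_supNorm_le c r).of_isClosed_subset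
        (isClosed_eq (continuous_supNorm.comp (by fun_prop)) continuous_const)
        fun z hz => le_of_eq hz
    have hFγ : IsClosed (F '' {z | supNorm (z - c) = r}) :=
      (hγ.image_of_continuousOn fun z hz =>
        (H.analyticAt z (hγU hz)).continuousAt.continuousWithinAt).isClosed
    have hK := hmaps hQ₁
    have hKc := isCompact_finitePart (complComponents_isClosed H.isOpen_image hK)
      (complComponents_infty_notMem H.infty_mem_image hK)
    have hKγ : finitePart (σ Q₁) ⊆ (F '' {z | supNorm (z - c) = r})ᶜ := by
      rintro w hw ⟨z, hz, rfl⟩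
      exact complComponents_subset hK hw (H.F_mem_image (hγU hz))
    obtain ⟨δ, hδ, hthick⟩ := hKc.exists_thickening_subset_open hFγ.isOpen_compl hKγ
    have hmem : Metric.thickening δ (finitePart (σ Q₁)) ∈ 𝓝ˢ (finitePart (σ Q₁)) :=
      Metric.isOpen_thickening.mem_nhdsSet.2 (Metric.self_subset_thickening hδ _)
    -- near each of the two squares there is a point of `Ω` that is mapped close to `σ Q₁`
    have hpt : ∀ Q ∈ complComponents Ω, σ Q = σ Q₁ → ∀ W ∈ 𝓝ˢ (finitePart Q),
        ∃ z ∈ finitePart Ω, z ∈ W ∧ F z ∈ Metric.thickening δ (finitePart (σ Q₁)) := by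
      intro Q hQ hQQ W hW
      have h1 := hlim Q hQ
      rw [hQQ] at h1
      have h2 := eventually_inf_principal.1 (h1 hmem)
      obtain ⟨c', s', hs', hQc', -⟩ := (hsq Q hQ).exists_finitePart_eq
      obtain ⟨ε', hε', hring'⟩ := exists_ring_subset H.isOpen hfin hQ hQc'
      have h3 := inter_mem h2 hW
      rw [hQc'] at h3
      obtain ⟨η, hη, hsub⟩ := exists_supNorm_lt_subset h3
      obtain ⟨z, hz⟩ := exists_supNorm_sub_eq c' (s := s' + min η ε' / 2)
        (by positivity)
      have h4 : 0 < min η ε' := lt_min hη hε'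
      have h5 : min η ε' ≤ η := min_le_left _ _
      have h6 : min η ε' ≤ ε' := min_le_right _ _
      have hzU := hring' z (by rw [hz]; linarith) (by rw [hz]; linarith)
      have hzs := hsub (show supNorm (z - c') < s' + η by rw [hz]; linarith)
      exact ⟨z, hzU, hzs.2, hzs.1 hzU⟩
    have hcont : Continuous fun z => supNorm (z - c) := continuous_supNorm.comp (by fun_prop)
    obtain ⟨z₁, hz₁U, hz₁, hz₁K⟩ := hpt Q₁ hQ₁ rfl {z | supNorm (z - c) < r} (by
      rw [hQc]; exact mem_nhdsSet_supNorm_le (half_pos hε))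
    obtain ⟨z₂, hz₂U, hz₂, hz₂K⟩ := hpt Q₂ hQ₂ heq.symm {z | r < supNorm (z - c)} (by
      refine (isOpen_lt continuous_const hcont).mem_nhdsSet.2 fun z hz => ?_
      by_contra hcon
      have hle : supNorm (z - c) ≤ r := not_lt.1 hcon
      by_cases hzs : supNorm (z - c) ≤ s
      · have : z ∈ finitePart Q₁ := by rw [hQc]; exact hzs
        exact hne (complComponents_eq_of_mem hQ₁ hQ₂ this hz)
      · exact complComponents_subset hQ₂ hz (hring z (not_le.1 hzs) (by linarith)))
    obtain ⟨k₁, hk₁, hd₁⟩ := Metric.mem_thickening_iff.1 hz₁K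
    obtain ⟨k₂, hk₂, hd₂⟩ := Metric.mem_thickening_iff.1 hz₂K
    have hball : ∀ k ∈ finitePart (σ Q₁),
        Metric.ball k δ ⊆ Metric.thickening δ (finitePart (σ Q₁)) := fun k hk w hw =>
      Metric.mem_thickening_iff.2 ⟨k, hk, hw⟩
    have hconn := (isConnected_finitePart_of_mem H.infty_mem_image hK).isPreconnected
    refine not_isPreconnected_of_separated (isOpen_finitePart H.isOpen)
      (isPreconnected_finitePart H.isOpen H.isPreconnected H.infty_mem) H.analyticAt
      H.injOn_finitePart (by positivity : 0 < r) hγU hz₁U hz₂U hz₁ hz₂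
      (T := (finitePart (σ Q₁) ∪ Metric.ball k₁ δ) ∪ Metric.ball k₂ δ) ?_
      (Or.inl (Or.inr hd₁)) (Or.inr hd₂) ?_
    · refine disjoint_left.2 fun w hw => hthick ?_
      rcases hw with (hw | hw) | hw
      · exact Metric.self_subset_thickening hδ _ hw
      · exact hball k₁ hk₁ hw
      · exact hball k₂ hk₂ hw
    · refine (hconn.union k₁ hk₁ (Metric.mem_ball_self hδ)
        (convex_ball _ _).isPreconnected).union k₂ (Or.inl hk₂) (Metric.mem_ball_self hδ)
        (convex_ball _ _).isPreconnected
  · rintro _ ⟨q, hq, rfl⟩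
    have : Finite (complComponents Ω) := hfin
    obtain ⟨Q, hQ⟩ := complement_component_mem_range H.isOpen ⟨_, H.infty_mem⟩ H.map_nhds
      (ι := complComponents Ω) (Q := fun Q => Q) (by
        rw [← sUnion_eq_iUnion, sUnion_complComponents]) (σ := p) hp ht hq
    exact ⟨Q, Q.2, (hσQ Q Q.2).trans hQ.symm⟩

end NormalizedConformal

/-! ### The length estimate on vertical segments -/

theorem volume_im_image_le {K : Set (OnePoint ℂ)} (hK : IsCompact (finitePart K)) :
    volume (Complex.im '' finitePart K) ≤ ENNReal.ofReal (verticalVariation K) := by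
  have hc := hK.image Complex.continuous_im
  rw [verticalVariation, ← Real.volume_Icc]
  exact measure_mono (subset_Icc_csInf_csSup hc.bddBelow hc.bddAbove)

theorem verticalVariation_nonneg {K : Set (OnePoint ℂ)} (hK : IsCompact (finitePart K)) :
    0 ≤ verticalVariation K := by
  have hc := hK.image Complex.continuous_im
  rcases (Complex.im '' finitePart K).eq_empty_or_nonempty with h | h
  · simp [verticalVariation, h]
  · exact sub_nonneg.2 (csInf_le_csSup h hc.bddBelow hc.bddAbove)

/-- The length estimate on a vertical segment. The image of the segment under the set-valued map
that sends `z` to `{F z}` or, if `z` lies in the complementary component `Q`, to `σ Q`, is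
connected. Hence its projection to the imaginary axis covers the whole interval between the
values at the end points. -/
theorem NormalizedConformal.ofReal_im_sub_le {Ω : Set (OnePoint ℂ)}
    {f : OnePoint ℂ → OnePoint ℂ} {F : ℂ → ℂ} {a : ℂ} (H : NormalizedConformal Ω f F a)
    (hfin : (complComponents Ω).Finite) {σ : Set (OnePoint ℂ) → Set (OnePoint ℂ)}
    (hσ : MapsTo σ (complComponents Ω) (complComponents (f '' Ω)))
    (hlim : ∀ Q ∈ complComponents Ω, Tendsto F (𝓝ˢ (finitePart Q) ⊓ 𝓟 (finitePart Ω))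
        (𝓝ˢ (finitePart (σ Q)))) (x Y : ℝ) (hY : 0 ≤ Y)
    (hbot : (⟨x, -Y⟩ : ℂ) ∈ finitePart Ω) (htop : (⟨x, Y⟩ : ℂ) ∈ finitePart Ω) :
    ENNReal.ofReal ((F ⟨x, Y⟩).im - (F ⟨x, -Y⟩).im) ≤
      (∫⁻ y in {y | y ∈ Icc (-Y) Y ∧ (⟨x, y⟩ : ℂ) ∈ finitePart Ω}, ‖deriv F ⟨x, y⟩‖ₑ) +
      ∑ Q ∈ hfin.toFinset, (Complex.re '' finitePart Q).indicator
        (fun _ => ENNReal.ofReal (verticalVariation (σ Q))) x := by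
  classical
  set U := finitePart Ω with hU
  have hUo : IsOpen U := isOpen_finitePart H.isOpen
  set comp : ℂ → Set (OnePoint ℂ) := fun z => connectedComponentIn Ωᶜ (z : OnePoint ℂ) with hcomp
  have hcompmem : ∀ z ∉ U, comp z ∈ complComponents Ω := fun z hz => ⟨z, hz, rfl⟩
  have hcompself : ∀ z ∉ U, z ∈ finitePart (comp z) := fun z hz => mem_connectedComponentIn hz
  set Φ : ℝ → Set ℝ := fun y => if (⟨x, y⟩ : ℂ) ∈ U then {(F ⟨x, y⟩).im} else
    Complex.im '' finitePart (σ (comp ⟨x, y⟩)) with hΦ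
  have hΦU : ∀ y, (⟨x, y⟩ : ℂ) ∈ U → Φ y = {(F ⟨x, y⟩).im} := fun y hy => if_pos hy
  have hΦn : ∀ y, (⟨x, y⟩ : ℂ) ∉ U → Φ y = Complex.im '' finitePart (σ (comp ⟨x, y⟩)) :=
    fun y hy => if_neg hy
  have hline : Continuous fun y : ℝ => (⟨x, y⟩ : ℂ) := by
    have : (fun y : ℝ => (⟨x, y⟩ : ℂ)) = fun y : ℝ => (x : ℂ) + y * Complex.I := by
      funext y; exact (Complex.mk_eq_add_mul_I x y)
    rw [this]; fun_prop
  have hpre : IsPreconnected (⋃ y ∈ Icc (-Y) Y, Φ y) := by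
    refine isPreconnected_biUnion_of_upperSemicontinuous isPreconnected_Icc (fun y _ => ?_)
      (fun y _ W hW hyW => mem_nhdsWithin_of_mem_nhds ?_)
    · by_cases hy : (⟨x, y⟩ : ℂ) ∈ U
      · rw [hΦU y hy]; exact isConnected_singleton
      · rw [hΦn y hy]
        exact (isConnected_finitePart_of_mem H.infty_mem_image (hσ (hcompmem _ hy))).image _
          Complex.continuous_im.continuousOn
    · by_cases hy : (⟨x, y⟩ : ℂ) ∈ U
      · rw [hΦU y hy, singleton_subset_iff] at hyW
        have h1 : ∀ᶠ z in 𝓝 (⟨x, y⟩ : ℂ), z ∈ U ∧ (F z).im ∈ W :=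
          (hUo.eventually_mem hy).and
            ((Complex.continuous_im.continuousAt.comp (H.analyticAt _ hy).continuousAt)
              (hW.mem_nhds hyW))
        filter_upwards [hline.continuousAt h1] with y' hy'
        rw [hΦU y' hy'.1, singleton_subset_iff]
        exact hy'.2
      · rw [hΦn y hy, image_subset_iff] at hyW
        have hQ := hcompmem _ hy
        have h1 : ∀ᶠ z in 𝓝 (⟨x, y⟩ : ℂ), z ∈ U → (F z).im ∈ W :=
          nhds_le_nhdsSet (hcompself _ hy) (eventually_inf_principal.1
            (hlim _ hQ ((hW.preimage Complex.continuous_im).mem_nhdsSet.2 hyW)))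
        have h2 := nhds_le_nhdsSet (hcompself _ hy)
          (eventually_mem_of_finite_complComponents H.isOpen hfin hQ)
        filter_upwards [hline.continuousAt h1, hline.continuousAt h2] with y' h1' h2'
        by_cases hy' : (⟨x, y'⟩ : ℂ) ∈ U
        · rw [hΦU y' hy', singleton_subset_iff]
          exact h1' hy'
        · rw [hΦn y' hy', image_subset_iff]
          have : comp ⟨x, y'⟩ = comp ⟨x, y⟩ :=
            complComponents_eq_of_mem (hcompmem _ hy') hQ (hcompself _ hy') (h2' hy')
          rw [this]
          exact hyW
  have hcover : Icc (F ⟨x, -Y⟩).im (F ⟨x, Y⟩).im ⊆ ⋃ y ∈ Icc (-Y) Y, Φ y := by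
    refine hpre.Icc_subset (mem_iUnion₂.2 ⟨-Y, ⟨le_rfl, by linarith⟩, ?_⟩)
      (mem_iUnion₂.2 ⟨Y, ⟨by linarith, le_rfl⟩, ?_⟩)
    · rw [hΦU _ hbot]; rfl
    · rw [hΦU _ htop]; rfl
  set s := {y | y ∈ Icc (-Y) Y ∧ (⟨x, y⟩ : ℂ) ∈ U} with hs
  have hsm : MeasurableSet s := measurableSet_Icc.inter (hUo.preimage hline).measurableSet
  have hsplit : (⋃ y ∈ Icc (-Y) Y, Φ y) ⊆ ((fun y : ℝ => (F ⟨x, y⟩).im) '' s) ∪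
      ⋃ Q ∈ hfin.toFinset, if x ∈ Complex.re '' finitePart Q then
        Complex.im '' finitePart (σ Q) else ∅ := by
    intro t ht
    obtain ⟨y, hy, hty⟩ := mem_iUnion₂.1 ht
    by_cases hyU : (⟨x, y⟩ : ℂ) ∈ U
    · rw [hΦU y hyU] at hty
      exact Or.inl ⟨y, ⟨hy, hyU⟩, hty.symm⟩
    · rw [hΦn y hyU] at hty
      refine Or.inr (mem_iUnion₂.2 ⟨comp ⟨x, y⟩, hfin.mem_toFinset.2 (hcompmem _ hyU), ?_⟩)
      rw [if_pos ⟨_, hcompself _ hyU, rfl⟩]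
      exact hty
  have hderiv : ∀ y ∈ s, HasDerivWithinAt (fun y : ℝ => (F ⟨x, y⟩).im)
      (deriv F ⟨x, y⟩ * Complex.I).im s y := by
    intro y hy
    have h1 : HasDerivAt (fun y : ℝ => (⟨x, y⟩ : ℂ)) Complex.I y := by
      have : (fun y : ℝ => (⟨x, y⟩ : ℂ)) = fun y : ℝ => (x : ℂ) + y * Complex.I := by
        funext y; exact (Complex.mk_eq_add_mul_I x y)
      rw [this]
      simpa using ((Complex.ofRealCLM.hasDerivAt (x := y)).mul_const Complex.I).const_add (x : ℂ)
    have h2 := (H.analyticAt _ hy.2).differentiableAt.hasDerivAt.comp y h1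
    exact (Complex.imCLM.hasFDerivAt.comp_hasDerivAt y h2).hasDerivWithinAt
  calc ENNReal.ofReal ((F ⟨x, Y⟩).im - (F ⟨x, -Y⟩).im)
      = volume (Icc (F ⟨x, -Y⟩).im (F ⟨x, Y⟩).im) := Real.volume_Icc.symm
    _ ≤ volume ((fun y : ℝ => (F ⟨x, y⟩).im) '' s) +
        volume (⋃ Q ∈ hfin.toFinset, if x ∈ Complex.re '' finitePart Q then
          Complex.im '' finitePart (σ Q) else ∅) :=
        (measure_mono (hcover.trans hsplit)).trans (measure_union_le _ _)
    _ ≤ (∫⁻ y in s, ‖deriv F ⟨x, y⟩‖ₑ) + ∑ Q ∈ hfin.toFinset,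
        (Complex.re '' finitePart Q).indicator
          (fun _ => ENNReal.ofReal (verticalVariation (σ Q))) x := by
      refine add_le_add ?_ ((measure_biUnion_finset_le _ _).trans (Finset.sum_le_sum ?_))
      · refine (addHaar_image_le_lintegral_abs_det_fderiv volume hsm
          (fun y hy => (hderiv y hy).hasFDerivWithinAt)).trans (lintegral_mono fun y => ?_)
        rw [ContinuousLinearMap.det_toSpanSingleton, ← ofReal_norm]
        refine ENNReal.ofReal_le_ofReal ((Complex.abs_im_le_norm _).trans ?_)
        simp
      · intro Q hQ
        by_cases hx : x ∈ Complex.re '' finitePart Q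
        · rw [if_pos hx, indicator_of_mem hx]
          have hQ' := hσ (hfin.mem_toFinset.1 hQ)
          exact volume_im_image_le (isCompact_finitePart
            (complComponents_isClosed H.isOpen_image hQ')
            (complComponents_infty_notMem H.infty_mem_image hQ'))
        · rw [if_neg hx]; simp

/-! ### The length inequality -/

theorem lintegral_vertical_slices {S : Set ℂ} (hS : MeasurableSet S) {g : ℂ → ENNReal}
    (hg : Measurable g) :
    ∫⁻ x : ℝ, ∫⁻ y in {y : ℝ | (⟨x, y⟩ : ℂ) ∈ S}, g ⟨x, y⟩ = ∫⁻ z in S, g z := by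
  have hm : Measurable (S.indicator g) := hg.indicator hS
  have hmk : Measurable fun p : ℝ × ℝ => (⟨p.1, p.2⟩ : ℂ) :=
    Complex.measurableEquivRealProd.symm.measurable
  rw [← lintegral_indicator hS,
    ← Complex.volume_preserving_equiv_real_prod.symm.lintegral_comp hm, Measure.volume_eq_prod,
    lintegral_prod (fun p => S.indicator g (Complex.measurableEquivRealProd.symm p))
      (hm.comp Complex.measurableEquivRealProd.symm.measurable).aemeasurable]
  refine lintegral_congr fun x => ?_
  have hx : MeasurableSet {y : ℝ | (⟨x, y⟩ : ℂ) ∈ S} :=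
    (hmk.comp measurable_prodMk_left) hS
  rw [← lintegral_indicator hx]
  rfl

theorem ofReal_integral_le_lintegral {α : Type*} [MeasurableSpace α] {μ : Measure α} (g : α → ℝ) :
    ENNReal.ofReal (∫ x, g x ∂μ) ≤ ∫⁻ x, ENNReal.ofReal (g x) ∂μ := by
  by_cases hg : Integrable g μ
  · rw [integral_eq_lintegral_pos_part_sub_lintegral_neg_part hg]
    refine (ENNReal.ofReal_le_ofReal (sub_le_self _ ENNReal.toReal_nonneg)).trans ?_
    exact ENNReal.ofReal_toReal_le
  · simp [integral_undef hg]

theorem integral_sqrt_sq_sub_sq {R : ℝ} (hR : 0 < R) :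
    ∫ x in (-R)..R, √(R ^ 2 - x ^ 2) = Real.pi * R ^ 2 / 2 := by
  have h := intervalIntegral.integral_comp_mul_left (a := -1) (b := 1)
    (fun x => √(R ^ 2 - x ^ 2)) hR.ne'
  have h2 : ∀ x : ℝ, √(R ^ 2 - (R * x) ^ 2) = R * √(1 - x ^ 2) := by
    intro x
    rw [show R ^ 2 - (R * x) ^ 2 = R ^ 2 * (1 - x ^ 2) by ring,
      Real.sqrt_mul (by positivity), Real.sqrt_sq hR.le]
  simp only [h2, intervalIntegral.integral_const_mul, integral_sqrt_one_sub_sq, mul_neg, mul_one,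
    smul_eq_mul] at h
  field_simp at h
  linarith

theorem measurableSet_re_image {K : Set ℂ} (hK : IsCompact K) :
    MeasurableSet (Complex.re '' K) := (hK.image Complex.continuous_re).measurableSet

namespace IsAxisSquare

variable {Q : Set (OnePoint ℂ)}

theorem exists_eq_reProdIm (h : IsAxisSquare Q) : ∃ x y : ℝ, 0 ≤ verticalVariation Q ∧
    finitePart Q = Icc x (x + verticalVariation Q) ×ℂ Icc y (y + verticalVariation Q) := by
  obtain ⟨x, y, s, hs, rfl⟩ := h
  have hfp : finitePart ((fun z : ℂ => (z : OnePoint ℂ)) ''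
      (Icc x (x + s) ×ℂ Icc y (y + s))) = Icc x (x + s) ×ℂ Icc y (y + s) := by
    rw [finitePart, preimage_image_eq _ OnePoint.coe_injective]
  have him : Complex.im '' (Icc x (x + s) ×ℂ Icc y (y + s)) = Icc y (y + s) := by
    ext t
    constructor
    · rintro ⟨z, hz, rfl⟩; exact hz.2
    · intro ht; exact ⟨⟨x, t⟩, ⟨⟨le_rfl, by simpa using hs⟩, ht⟩, rfl⟩
  have hV : verticalVariation ((fun z : ℂ => (z : OnePoint ℂ)) ''
      (Icc x (x + s) ×ℂ Icc y (y + s))) = s := by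
    rw [verticalVariation, hfp, him, csSup_Icc (by linarith), csInf_Icc (by linarith)]
    ring
  exact ⟨x, y, by rw [hV]; exact hs, by rw [hV, hfp]⟩

theorem volume_re_image_le (h : IsAxisSquare Q) :
    volume (Complex.re '' finitePart Q) ≤ ENNReal.ofReal (verticalVariation Q) := by
  obtain ⟨x, y, -, hQ⟩ := h.exists_eq_reProdIm
  have : Complex.re '' finitePart Q ⊆ Icc x (x + verticalVariation Q) := by
    rintro _ ⟨z, hz, rfl⟩
    rw [hQ] at hz
    exact hz.1
  refine (measure_mono this).trans ?_
  rw [Real.volume_Icc, add_sub_cancel_left]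

theorem volume_finitePart (h : IsAxisSquare Q) :
    volume (finitePart Q) = ENNReal.ofReal (verticalVariation Q ^ 2) := by
  obtain ⟨x, y, hV, hQ⟩ := h.exists_eq_reProdIm
  rw [hQ, Complex.reProdIm, ← Complex.volume_preserving_equiv_real_prod.symm.measure_preimage
    ((measurableSet_Icc.preimage Complex.measurable_re).inter
      (measurableSet_Icc.preimage Complex.measurable_im)).nullMeasurableSet]
  have : Complex.measurableEquivRealProd.symm ⁻¹' (Complex.re ⁻¹' Icc x (x + verticalVariation Q) ∩
      Complex.im ⁻¹' Icc y (y + verticalVariation Q)) =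
      Icc x (x + verticalVariation Q) ×ˢ Icc y (y + verticalVariation Q) := by
    ext p; rfl
  rw [this, Measure.volume_eq_prod, Measure.prod_prod, Real.volume_Icc, Real.volume_Icc,
    add_sub_cancel_left, add_sub_cancel_left, ← ENNReal.ofReal_mul hV, sq]

theorem planarArea_eq (h : IsAxisSquare Q) : planarArea Q = verticalVariation Q ^ 2 := by
  rw [planarArea, Measure.real, h.volume_finitePart, ENNReal.toReal_ofReal (sq_nonneg _)]

end IsAxisSquare

namespace NormalizedConformal

variable {Ω : Set (OnePoint ℂ)} {f : OnePoint ℂ → OnePoint ℂ} {F : ℂ → ℂ} {a : ℂ}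

theorem exists_asymp_mem (H : NormalizedConformal Ω f F a) : ∃ C r : ℝ, 0 ≤ C ∧ 1 ≤ r ∧
    ∀ z : ℂ, r ≤ ‖z‖ → z ∈ finitePart Ω ∧ ‖F z - z - a / z‖ ≤ C / ‖z‖ ^ 2 := by
  obtain ⟨C, r, h⟩ := H.asymp
  obtain ⟨ρ, hρ, hρU⟩ := exists_norm_le_mem_finitePart (H.isOpen.mem_nhds H.infty_mem)
  refine ⟨|C|, max (max r ρ) 1, abs_nonneg _, le_max_right _ _, fun z hz => ?_⟩
  simp only [max_le_iff] at hz
  refine ⟨hρU z hz.1.2, (h z hz.1.1).trans ?_⟩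
  gcongr
  exact le_abs_self C

/-- Integration of the length estimate over the vertical chords of a large disc. -/
theorem length_inequality (H : NormalizedConformal Ω f F a)
    (hsq : ∀ Q ∈ complComponents Ω, IsAxisSquare Q)
    (hfin : (complComponents Ω).Finite) {σ : Set (OnePoint ℂ) → Set (OnePoint ℂ)}
    (hσ : MapsTo σ (complComponents Ω) (complComponents (f '' Ω)))
    (hlim : ∀ Q ∈ complComponents Ω, Tendsto F (𝓝ˢ (finitePart Q) ⊓ 𝓟 (finitePart Ω))
        (𝓝ˢ (finitePart (σ Q)))) :
    ∃ C r : ℝ, 0 < r ∧ ∀ R, r ≤ R →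
      ENNReal.ofReal (Real.pi * R ^ 2 - Real.pi * a.re - C / R) ≤
      (∫⁻ z in Metric.closedBall 0 R ∩ finitePart Ω, ‖deriv F z‖ₑ) +
        ∑ Q ∈ hfin.toFinset, ENNReal.ofReal (verticalVariation (σ Q) * verticalVariation Q) := by
  obtain ⟨C, r, hC, hr, hCr⟩ := H.exists_asymp_mem
  refine ⟨4 * C, r, by linarith, fun R hrR => ?_⟩
  have hR : 0 < R := by linarith
  set U := finitePart Ω with hU
  have hUm : MeasurableSet U := (isOpen_finitePart H.isOpen).measurableSet
  have hQV : ∀ Q ∈ hfin.toFinset, 0 ≤ verticalVariation (σ Q) := fun Q hQ => by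
    have hQ' := hσ (hfin.mem_toFinset.1 hQ)
    exact verticalVariation_nonneg (isCompact_finitePart
      (complComponents_isClosed H.isOpen_image hQ')
      (complComponents_infty_notMem H.infty_mem_image hQ'))
  have hQm : ∀ Q ∈ hfin.toFinset, MeasurableSet (Complex.re '' finitePart Q) := fun Q hQ =>
    measurableSet_re_image (isCompact_finitePart
      (complComponents_isClosed H.isOpen (hfin.mem_toFinset.1 hQ))
      (complComponents_infty_notMem H.infty_mem (hfin.mem_toFinset.1 hQ)))
  set g : ℝ → ℝ := fun x => 2 * (1 - a.re / R ^ 2) * √(R ^ 2 - x ^ 2) - 2 * C / R ^ 2 with hg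
  have hint : ∫ x in Icc (-R) R, g x = Real.pi * R ^ 2 - Real.pi * a.re - 4 * C / R := by
    rw [integral_Icc_eq_integral_Ioc, ← intervalIntegral.integral_of_le (by linarith), hg,
      intervalIntegral.integral_sub, intervalIntegral.integral_const_mul,
      integral_sqrt_sq_sub_sq hR, intervalIntegral.integral_const]
    · rw [smul_eq_mul]
      field_simp
      ring
    · exact Continuous.intervalIntegrable (by fun_prop) _ _
    · exact Continuous.intervalIntegrable (by fun_prop) _ _
  have hpoint : ∀ x ∈ Icc (-R) R, ENNReal.ofReal (g x) ≤
      (∫⁻ y in {y : ℝ | (⟨x, y⟩ : ℂ) ∈ Metric.closedBall 0 R ∩ U}, ‖deriv F ⟨x, y⟩‖ₑ) +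
      ∑ Q ∈ hfin.toFinset, (Complex.re '' finitePart Q).indicator
        (fun _ => ENNReal.ofReal (verticalVariation (σ Q))) x := by
    intro x hx
    have hx2 : x ^ 2 ≤ R ^ 2 := sq_le_sq' hx.1 hx.2
    set Y := √(R ^ 2 - x ^ 2) with hY
    have hY0 : 0 ≤ Y := Real.sqrt_nonneg _
    have hY2 : Y ^ 2 = R ^ 2 - x ^ 2 := Real.sq_sqrt (by linarith)
    have hnorm : ∀ y : ℝ, y ^ 2 = Y ^ 2 → ‖(⟨x, y⟩ : ℂ)‖ = R := by
      intro y hy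
      rw [← sq_eq_sq₀ (norm_nonneg _) hR.le, ← Complex.normSq_eq_norm_sq, Complex.normSq_mk]
      linarith [hy, hY2]
    -- on the circle of radius `R` one has `1 / z = conj z / R ^ 2`
    have him : ∀ y : ℝ, y ^ 2 = Y ^ 2 →
        |(F ⟨x, y⟩).im - (y + (a.im * x - a.re * y) / R ^ 2)| ≤ C / R ^ 2 := by
      intro y hy
      have h1 := (hCr ⟨x, y⟩ (by rw [hnorm y hy]; exact hrR)).2
      rw [hnorm y hy] at h1
      have hns : Complex.normSq (⟨x, y⟩ : ℂ) = R ^ 2 := by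
        rw [Complex.normSq_eq_norm_sq, hnorm y hy]
      have h2 : (F ⟨x, y⟩ - ⟨x, y⟩ - a / ⟨x, y⟩ : ℂ).im =
          (F ⟨x, y⟩).im - (y + (a.im * x - a.re * y) / R ^ 2) := by
        rw [Complex.sub_im, Complex.sub_im, Complex.div_im, hns]
        ring
      rw [← h2]
      exact (Complex.abs_im_le_norm _).trans h1
    have ht := abs_le.1 (him Y rfl)
    have hb := abs_le.1 (him (-Y) (by ring))
    have hgx : g x ≤ (F ⟨x, Y⟩).im - (F ⟨x, -Y⟩).im := by
      have : g x = (Y + (a.im * x - a.re * Y) / R ^ 2) -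
          (-Y + (a.im * x - a.re * -Y) / R ^ 2) - C / R ^ 2 - C / R ^ 2 := by
        rw [hg]; simp only [← hY]; ring
      linarith [ht.1, hb.2]
    refine (ENNReal.ofReal_le_ofReal hgx).trans ((H.ofReal_im_sub_le hfin hσ hlim x Y hY0
      (hCr _ (by rw [hnorm _ (by ring)]; exact hrR)).1
      (hCr _ (by rw [hnorm _ rfl]; exact hrR)).1).trans (add_le_add ?_ le_rfl))
    refine lintegral_mono_set fun y hy => ⟨?_, hy.2⟩
    rw [mem_closedBall_zero_iff, ← sq_le_sq₀ (norm_nonneg _) hR.le, ← Complex.normSq_eq_norm_sq,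
      Complex.normSq_mk]
    nlinarith [sq_le_sq' hy.1.1 hy.1.2]
  have hmeas : Measurable fun z => ‖deriv F z‖ₑ := (measurable_deriv F).enorm
  calc ENNReal.ofReal (Real.pi * R ^ 2 - Real.pi * a.re - 4 * C / R)
      = ENNReal.ofReal (∫ x in Icc (-R) R, g x) := by rw [hint]
    _ ≤ ∫⁻ x in Icc (-R) R, ENNReal.ofReal (g x) := ofReal_integral_le_lintegral _
    _ ≤ ∫⁻ x in Icc (-R) R,
        ((∫⁻ y in {y : ℝ | (⟨x, y⟩ : ℂ) ∈ Metric.closedBall 0 R ∩ U}, ‖deriv F ⟨x, y⟩‖ₑ) +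
        ∑ Q ∈ hfin.toFinset, (Complex.re '' finitePart Q).indicator
          (fun _ => ENNReal.ofReal (verticalVariation (σ Q))) x) :=
        setLIntegral_mono' measurableSet_Icc hpoint
    _ ≤ ∫⁻ x : ℝ,
        ((∫⁻ y in {y : ℝ | (⟨x, y⟩ : ℂ) ∈ Metric.closedBall 0 R ∩ U}, ‖deriv F ⟨x, y⟩‖ₑ) +
        ∑ Q ∈ hfin.toFinset, (Complex.re '' finitePart Q).indicator
          (fun _ => ENNReal.ofReal (verticalVariation (σ Q))) x) := setLIntegral_le_lintegral _ _
    _ = (∫⁻ z in Metric.closedBall 0 R ∩ U, ‖deriv F z‖ₑ) +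
        ∑ Q ∈ hfin.toFinset, ∫⁻ x, (Complex.re '' finitePart Q).indicator
          (fun _ => ENNReal.ofReal (verticalVariation (σ Q))) x := by
        rw [lintegral_add_right, lintegral_vertical_slices
          (Metric.isClosed_closedBall.measurableSet.inter hUm) hmeas, lintegral_finsetSum']
        · exact fun Q hQ => (measurable_const.indicator (hQm Q hQ)).aemeasurable
        · exact Finset.measurable_fun_sum _ fun Q hQ => measurable_const.indicator (hQm Q hQ)
    _ ≤ _ := by
        refine add_le_add le_rfl (Finset.sum_le_sum fun Q hQ => ?_)
        rw [lintegral_indicator_const (hQm Q hQ), ENNReal.ofReal_mul (hQV Q hQ)]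
        gcongr
        exact (hsq Q (hfin.mem_toFinset.1 hQ)).volume_re_image_le

end NormalizedConformal

/-! ### The area inequality -/

theorem lintegral_enorm_deriv_sq_eq_volume_image {F : ℂ → ℂ} {S : Set ℂ} (hS : MeasurableSet S)
    (hF : ∀ z ∈ S, AnalyticAt ℂ F z) (hinj : InjOn F S) :
    ∫⁻ z in S, ‖deriv F z‖ₑ ^ 2 = volume (F '' S) := by
  rw [← lintegral_abs_det_fderiv_eq_addHaar_image volume hS (fun z hz =>
    ((hF z hz).differentiableAt.hasFDerivAt.restrictScalars ℝ).hasFDerivWithinAt) hinj]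
  refine lintegral_congr fun z => ?_
  have : ((fderiv ℂ F z).restrictScalars ℝ).det = ‖deriv F z‖ ^ 2 := by
    rw [← toSpanSingleton_deriv]
    simp [ContinuousLinearMap.det, LinearMap.det_restrictScalars, Algebra.norm_complex_eq,
      Complex.normSq_eq_norm_sq]
  rw [this, abs_of_nonneg (by positivity), ENNReal.ofReal_pow (norm_nonneg _), ofReal_norm]

/-- The real linear map `w ↦ w - b * conj w`. -/
noncomputable def subConjMul (b : ℂ) : ℂ →ₗ[ℝ] ℂ :=
  LinearMap.id - (LinearMap.mulLeft ℝ b) ∘ₗ Complex.conjAe.toLinearMap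

theorem subConjMul_apply (b w : ℂ) : subConjMul b w = w - b * (starRingEnd ℂ) w := rfl

theorem det_subConjMul (b : ℂ) : LinearMap.det (subConjMul b) = 1 - ‖b‖ ^ 2 := by
  rw [← LinearMap.det_toMatrix Complex.basisOneI, Matrix.det_fin_two]
  simp only [LinearMap.toMatrix_apply, Complex.coe_basisOneI_repr, Complex.coe_basisOneI,
    subConjMul_apply]
  rw [← Complex.normSq_eq_norm_sq, Complex.normSq_apply]
  simp
  ring

namespace NormalizedConformal

variable {Ω : Set (OnePoint ℂ)} {f : OnePoint ℂ → OnePoint ℂ} {F : ℂ → ℂ} {a : ℂ}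

/-- The curve `f (|z| = R)` is almost the ellipse `{z + (a / R²) conj z : |z| = R}`. The set that
it encloses is mapped into an almost optimal disc by the inverse, up to a factor, of the linear map
`z ↦ z + (a / R²) conj z`. -/
theorem exists_norm_subConjMul_le (H : NormalizedConformal Ω f F a) :
    ∃ C r : ℝ, 0 ≤ C ∧ 1 ≤ r ∧ ∀ R, r ≤ R → ∀ w : ℂ,
      (w ∉ finitePart (f '' Ω) ∨ w ∈ F '' (Metric.closedBall 0 R ∩ finitePart Ω)) →
      ‖subConjMul (a / R ^ 2) w‖ ≤ R + C / R ^ 2 := by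
  obtain ⟨C, r, hC, hr, hCr⟩ := H.exists_asymp_mem
  obtain ⟨ρ, hρ, hρw⟩ := H.exists_eq_of_norm_ge r
  refine ⟨18 * C + ‖a‖ ^ 2, max 1 (max (2 * ρ) (6 * (‖a‖ + C))), by positivity, le_max_left _ _,
    fun R hR w hw => ?_⟩
  simp only [max_le_iff] at hR
  obtain ⟨hR1, hR2, hR3⟩ := hR
  have hR0 : 0 < R := by linarith
  have ha0 := norm_nonneg a
  have hc : ‖a / (R : ℂ) ^ 2‖ = ‖a‖ / R ^ 2 := by
    rw [norm_div, norm_pow, Complex.norm_real, Real.norm_of_nonneg hR0.le]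
  have hc4 : 4 * ‖a‖ / R ^ 2 ≤ 1 := by
    rw [div_le_one (by positivity)]
    nlinarith
  have hc1 : ‖a‖ / R ^ 2 ≤ 1 := by
    have : 4 * ‖a‖ / R ^ 2 = 4 * (‖a‖ / R ^ 2) := by ring
    have h0 : 0 ≤ ‖a‖ / R ^ 2 := by positivity
    linarith
  have hC' : 0 ≤ (18 * C + ‖a‖ ^ 2) / R ^ 2 := by positivity
  rw [subConjMul_apply]
  by_cases hwR : ‖w‖ ≤ R / 2
  · have h1 : ‖a / (R : ℂ) ^ 2 * (starRingEnd ℂ) w‖ ≤ ‖w‖ := by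
      rw [norm_mul, hc, RCLike.norm_conj]
      exact mul_le_of_le_one_left (norm_nonneg _) hc1
    linarith [norm_sub_le w (a / (R : ℂ) ^ 2 * (starRingEnd ℂ) w)]
  · obtain ⟨z, hzU, hzr, rfl⟩ := hρw w (by linarith)
    have hzR : ‖z‖ ≤ R := by
      rcases hw with hw | ⟨z', ⟨hz'R, hz'U⟩, hzz'⟩
      · exact (hw (H.F_mem_image hzU)).elim
      · rw [← H.injOn_finitePart hz'U hzU hzz']
        exact mem_closedBall_zero_iff.1 hz'R
    set t := ‖z‖ with ht
    have ht1 : 1 ≤ t := by linarith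
    have hz0 : z ≠ 0 := norm_pos_iff.1 (by linarith)
    set e := F z - z - a / z with he
    have heC : ‖e‖ ≤ C / t ^ 2 := (hCr z hzr.le).2
    have haz : ‖a / z‖ = ‖a‖ / t := norm_div _ _
    have hFz : F z = z + a / z + e := by rw [he]; ring
    have ht3 : R / 3 ≤ t := by
      have h1 : ‖F z‖ ≤ t + ‖a‖ / t + C / t ^ 2 := by
        rw [hFz]
        refine (norm_add_le _ _).trans (add_le_add ((norm_add_le _ _).trans ?_) heC)
        rw [haz]
      have h2 : ‖a‖ / t ≤ ‖a‖ := div_le_self ha0 ht1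
      have h3 : C / t ^ 2 ≤ C := div_le_self hC (one_le_pow₀ ht1)
      linarith
    have heR : ‖e‖ ≤ 9 * C / R ^ 2 := by
      refine heC.trans ?_
      calc C / t ^ 2 ≤ C / (R / 3) ^ 2 := by gcongr
        _ = 9 * C / R ^ 2 := by field_simp; ring
    have hmain : a / z - a / (R : ℂ) ^ 2 * (starRingEnd ℂ) z =
        a / z * ((1 - t ^ 2 / R ^ 2 : ℝ) : ℂ) := by
      have h1 : (starRingEnd ℂ) z = ((t ^ 2 : ℝ) : ℂ) / z := by
        rw [eq_div_iff hz0, mul_comm, Complex.mul_conj, Complex.normSq_eq_norm_sq]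
      rw [h1]
      push_cast
      ring
    have htR : 0 ≤ 1 - t ^ 2 / R ^ 2 := by
      rw [sub_nonneg, div_le_one (by positivity)]
      gcongr
    have hn1 : ‖a / z * ((1 - t ^ 2 / R ^ 2 : ℝ) : ℂ)‖ ≤ R - t := by
      rw [norm_mul, haz, Complex.norm_real, Real.norm_of_nonneg htR]
      have h1 : ‖a‖ / t * (1 - t ^ 2 / R ^ 2) = (R - t) * (‖a‖ * (R + t) / (t * R ^ 2)) := by
        field_simp
        ring
      rw [h1]
      refine mul_le_of_le_one_right (by linarith) ?_
      refine le_trans ?_ hc4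
      rw [div_le_div_iff₀ (by positivity) (by positivity)]
      have h2 : R + t ≤ 4 * t := by linarith
      calc ‖a‖ * (R + t) * R ^ 2 ≤ ‖a‖ * (4 * t) * R ^ 2 := by gcongr
        _ = 4 * ‖a‖ * (t * R ^ 2) := by ring
    have hn2 : ‖a / (R : ℂ) ^ 2 * (starRingEnd ℂ) (a / z)‖ ≤ ‖a‖ ^ 2 / R ^ 2 := by
      rw [norm_mul, hc, RCLike.norm_conj, haz]
      calc ‖a‖ / R ^ 2 * (‖a‖ / t) ≤ ‖a‖ / R ^ 2 * ‖a‖ := by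
            gcongr
            exact div_le_self ha0 ht1
        _ = ‖a‖ ^ 2 / R ^ 2 := by ring
    have hn3 : ‖a / (R : ℂ) ^ 2 * (starRingEnd ℂ) e‖ ≤ 9 * C / R ^ 2 := by
      rw [norm_mul, hc, RCLike.norm_conj]
      exact (mul_le_of_le_one_left (norm_nonneg _) hc1).trans heR
    have hsplit : F z - a / (R : ℂ) ^ 2 * (starRingEnd ℂ) (F z) =
        z + (a / z * ((1 - t ^ 2 / R ^ 2 : ℝ) : ℂ)) + e
          - a / (R : ℂ) ^ 2 * (starRingEnd ℂ) (a / z) - a / (R : ℂ) ^ 2 * (starRingEnd ℂ) e := by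
      rw [← hmain, hFz, map_add, map_add]
      ring
    rw [hsplit]
    calc _ ≤ ‖z‖ + ‖a / z * ((1 - t ^ 2 / R ^ 2 : ℝ) : ℂ)‖ + ‖e‖ +
          ‖a / (R : ℂ) ^ 2 * (starRingEnd ℂ) (a / z)‖ + ‖a / (R : ℂ) ^ 2 * (starRingEnd ℂ) e‖ := by
          refine (norm_sub_le _ _).trans (add_le_add ((norm_sub_le _ _).trans (add_le_add
            ((norm_add_le _ _).trans (add_le_add (norm_add_le _ _) le_rfl)) le_rfl)) le_rfl)
      _ ≤ t + (R - t) + 9 * C / R ^ 2 + ‖a‖ ^ 2 / R ^ 2 + 9 * C / R ^ 2 := by gcongr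
      _ = R + (18 * C + ‖a‖ ^ 2) / R ^ 2 := by ring

/-- The images of the points of a large disc and the complementary components of the image fill
an area of at most `πR² + O(1 / R)`. -/
theorem area_inequality (H : NormalizedConformal Ω f F a)
    (hfin : (complComponents (f '' Ω)).Finite) :
    ∃ C r : ℝ, 0 ≤ C ∧ 0 < r ∧ ∀ R, r ≤ R →
      (∫⁻ z in Metric.closedBall 0 R ∩ finitePart Ω, ‖deriv F z‖ₑ ^ 2) +
        ∑ K ∈ hfin.toFinset, ENNReal.ofReal (planarArea K) ≤
      ENNReal.ofReal (Real.pi * R ^ 2 + C / R) := by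
  obtain ⟨C, r, hC, hr, hCr⟩ := H.exists_norm_subConjMul_le
  set B₁ := 2 * Real.pi * C + Real.pi * C ^ 2 with hB₁
  have hpi := Real.pi_pos
  have hB₁0 : 0 ≤ B₁ := by positivity
  refine ⟨B₁ + 2 * ‖a‖ ^ 2 * (Real.pi + B₁), max r (2 * (‖a‖ + 1)), by positivity,
    by positivity,
    fun R hR => ?_⟩
  simp only [max_le_iff] at hR
  have hR1 : 1 ≤ R := by linarith
  have hR0 : 0 < R := by linarith
  have ha0 := norm_nonneg a
  set S := Metric.closedBall 0 R ∩ finitePart Ω with hS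
  have hSm : MeasurableSet S :=
    Metric.isClosed_closedBall.measurableSet.inter (isOpen_finitePart H.isOpen).measurableSet
  have hKc : ∀ K ∈ complComponents (f '' Ω), IsCompact (finitePart K) := fun K hK =>
    isCompact_finitePart (complComponents_isClosed H.isOpen_image hK)
      (complComponents_infty_notMem H.infty_mem_image hK)
  set E := F '' S ∪ ⋃ K ∈ hfin.toFinset, finitePart K with hE
  have hsum : (∫⁻ z in S, ‖deriv F z‖ₑ ^ 2) +
      ∑ K ∈ hfin.toFinset, ENNReal.ofReal (planarArea K) = volume E := by
    rw [lintegral_enorm_deriv_sq_eq_volume_image hSm (fun z hz => H.analyticAt z hz.2)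
      (H.injOn_finitePart.mono inter_subset_right), hE, measure_union,
      measure_biUnion_finset]
    · congr 1
      refine Finset.sum_congr rfl fun K hK => ?_
      rw [planarArea, Measure.real, ENNReal.ofReal_toReal]
      exact (hKc K (hfin.mem_toFinset.1 hK)).measure_lt_top.ne
    · intro K hK L hL hKL
      refine disjoint_left.2 fun z hzK hzL => hKL ?_
      exact complComponents_eq_of_mem (hfin.mem_toFinset.1 hK) (hfin.mem_toFinset.1 hL) hzK hzL
    · exact fun K hK => (hKc K (hfin.mem_toFinset.1 hK)).measurableSet
    · refine disjoint_left.2 fun w hw hwK => ?_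
      obtain ⟨K, hK, hwK⟩ := mem_iUnion₂.1 hwK
      obtain ⟨z, hz, rfl⟩ := hw
      exact complComponents_subset (hfin.mem_toFinset.1 hK) hwK (H.F_mem_image hz.2)
    · exact Finset.measurableSet_biUnion _ fun K hK =>
        (hKc K (hfin.mem_toFinset.1 hK)).measurableSet
  have hsub : subConjMul (a / R ^ 2) '' E ⊆ Metric.closedBall 0 (R + C / R ^ 2) := by
    rintro _ ⟨w, hw, rfl⟩
    rw [mem_closedBall_zero_iff]
    refine hCr R hR.1 w ?_
    rcases hw with hw | hw
    · exact Or.inr hw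
    · obtain ⟨K, hK, hwK⟩ := mem_iUnion₂.1 hw
      exact Or.inl fun h => complComponents_subset (hfin.mem_toFinset.1 hK) hwK h
  set q := ‖a‖ ^ 2 / R ^ 4 with hq
  have hnb : ‖a / (R : ℂ) ^ 2‖ ^ 2 = q := by
    rw [norm_div, norm_pow, Complex.norm_real, Real.norm_of_nonneg hR0.le, hq]
    ring
  have hq0 : 0 ≤ q := by positivity
  have hqR : q * R ^ 2 ≤ ‖a‖ ^ 2 / R := by
    have : q * R ^ 2 = ‖a‖ ^ 2 / R ^ 2 := by rw [hq]; field_simp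
    rw [this]
    apply div_le_div_of_nonneg_left (by positivity) hR0
    nlinarith
  have hq1 : q ≤ 1 / 2 := by
    rw [hq, div_le_div_iff₀ (by positivity) (by norm_num)]
    have h1 : 4 * ‖a‖ ^ 2 ≤ R ^ 2 := by nlinarith
    have h2 : R ^ 2 ≤ R ^ 4 := pow_le_pow_right₀ hR1 (by norm_num)
    linarith [sq_nonneg ‖a‖]
  have hvol := measure_mono (μ := volume) hsub
  rw [Measure.addHaar_image_linearMap, det_subConjMul, hnb, abs_of_nonneg (by linarith),
    Complex.volume_closedBall] at hvol
  have hvol' : ENNReal.ofReal (1 - q) * volume E ≤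
      ENNReal.ofReal (Real.pi * (R + C / R ^ 2) ^ 2) := by
    refine hvol.trans_eq ?_
    rw [← ENNReal.ofReal_pow (by positivity), mul_comm, ENNReal.ofReal_mul hpi.le]
    congr 1
    rw [ENNReal.ofReal, ENNReal.coe_inj]
    exact (Real.toNNReal_of_nonneg hpi.le).symm ▸ rfl
  have hX : Real.pi * (R + C / R ^ 2) ^ 2 ≤ Real.pi * R ^ 2 + B₁ / R := by
    have h1 : Real.pi * (R + C / R ^ 2) ^ 2 =
        Real.pi * R ^ 2 + 2 * Real.pi * C / R + Real.pi * C ^ 2 / R ^ 4 := by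
      field_simp
      ring
    have h2 : Real.pi * C ^ 2 / R ^ 4 ≤ Real.pi * C ^ 2 / R := by
      apply div_le_div_of_nonneg_left (by positivity) hR0
      exact le_self_pow₀ hR1 (by norm_num)
    have h3 : B₁ / R = 2 * Real.pi * C / R + Real.pi * C ^ 2 / R := by rw [hB₁]; ring
    linarith
  rw [hsum]
  have hne : ENNReal.ofReal (1 - q) ≠ 0 := by
    rw [Ne, ENNReal.ofReal_eq_zero]; linarith
  -- division by `1 - q` costs at most the factor `1 + 2 q`, since `q ≤ 1 / 2`
  have hfinal : Real.pi * R ^ 2 + B₁ / R ≤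
      (1 - q) * (Real.pi * R ^ 2 + (B₁ + 2 * ‖a‖ ^ 2 * (Real.pi + B₁)) / R) := by
    set X := Real.pi * R ^ 2 + B₁ / R with hXdef
    have hX0 : 0 ≤ X := by positivity
    have h1 : X ≤ (1 - q) * (X + 2 * q * X) := by
      have : (1 - q) * (X + 2 * q * X) - X = q * (1 - 2 * q) * X := by ring
      have h0 : 0 ≤ q * (1 - 2 * q) * X := by
        apply mul_nonneg (mul_nonneg hq0 (by linarith)) hX0
      linarith
    refine h1.trans (mul_le_mul_of_nonneg_left ?_ (by linarith))
    have h2 : X ≤ (Real.pi + B₁) * R ^ 2 := by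
      have : B₁ / R ≤ B₁ * R ^ 2 :=
        (div_le_self hB₁0 hR1).trans (le_mul_of_one_le_right hB₁0 (one_le_pow₀ hR1))
      rw [hXdef]; linarith
    have h3 : 2 * q * X ≤ 2 * ‖a‖ ^ 2 * (Real.pi + B₁) / R := by
      calc 2 * q * X ≤ 2 * q * ((Real.pi + B₁) * R ^ 2) := by gcongr
        _ = 2 * (Real.pi + B₁) * (q * R ^ 2) := by ring
        _ ≤ 2 * (Real.pi + B₁) * (‖a‖ ^ 2 / R) := by gcongr
        _ = 2 * ‖a‖ ^ 2 * (Real.pi + B₁) / R := by ring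
    have h4 : (B₁ + 2 * ‖a‖ ^ 2 * (Real.pi + B₁)) / R =
        B₁ / R + 2 * ‖a‖ ^ 2 * (Real.pi + B₁) / R := by ring
    rw [h4]
    linarith
  rw [← ENNReal.mul_le_mul_iff_right hne ENNReal.ofReal_ne_top,
    ← ENNReal.ofReal_mul (by linarith)]
  exact hvol'.trans (ENNReal.ofReal_le_ofReal (hX.trans hfinal))

end NormalizedConformal

/-! ### The energy inequality and the equality case -/

namespace NormalizedConformal

variable {Ω : Set (OnePoint ℂ)} {f : OnePoint ℂ → OnePoint ℂ} {F : ℂ → ℂ} {a : ℂ}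

theorem volume_add_sum_le (H : NormalizedConformal Ω f F a)
    (hsq : ∀ Q ∈ complComponents Ω, IsAxisSquare Q) (hfin : (complComponents Ω).Finite) :
    ∃ r : ℝ, 0 < r ∧ ∀ R, r ≤ R → volume (Metric.closedBall 0 R ∩ finitePart Ω) +
      ∑ Q ∈ hfin.toFinset, ENNReal.ofReal (verticalVariation Q ^ 2) ≤
        ENNReal.ofReal (Real.pi * R ^ 2) := by
  obtain ⟨r, hr, hrU⟩ := exists_norm_le_mem_finitePart (H.isOpen.mem_nhds H.infty_mem)
  refine ⟨r, hr, fun R hR => ?_⟩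
  have hQm : ∀ Q ∈ hfin.toFinset, MeasurableSet (finitePart Q) := fun Q hQ =>
    (isCompact_finitePart (complComponents_isClosed H.isOpen (hfin.mem_toFinset.1 hQ))
      (complComponents_infty_notMem H.infty_mem (hfin.mem_toFinset.1 hQ))).measurableSet
  have h1 : ∑ Q ∈ hfin.toFinset, ENNReal.ofReal (verticalVariation Q ^ 2) =
      volume (⋃ Q ∈ hfin.toFinset, finitePart Q) := by
    rw [measure_biUnion_finset _ hQm]
    · exact Finset.sum_congr rfl fun Q hQ =>
        ((hsq Q (hfin.mem_toFinset.1 hQ)).volume_finitePart).symm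
    · intro K hK L hL hKL
      refine disjoint_left.2 fun z hzK hzL => hKL ?_
      exact complComponents_eq_of_mem (hfin.mem_toFinset.1 hK) (hfin.mem_toFinset.1 hL) hzK hzL
  rw [h1, ← measure_union _ (Finset.measurableSet_biUnion _ hQm)]
  · have hsub : Metric.closedBall 0 R ∩ finitePart Ω ∪ ⋃ Q ∈ hfin.toFinset, finitePart Q ⊆
        Metric.closedBall 0 R := by
      refine union_subset inter_subset_left (iUnion₂_subset fun Q hQ z hz => ?_)
      rw [mem_closedBall_zero_iff]
      by_contra! hcon
      exact complComponents_subset (hfin.mem_toFinset.1 hQ) hz (hrU z (hR.trans hcon.le))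
    refine (measure_mono hsub).trans_eq ?_
    rw [Complex.volume_closedBall, ← ENNReal.ofReal_pow (by linarith), mul_comm,
      ENNReal.ofReal_mul Real.pi_pos.le]
    congr 1
    rw [ENNReal.ofReal, ENNReal.coe_inj]
    exact (Real.toNNReal_of_nonneg Real.pi_pos.le).symm ▸ rfl
  · refine disjoint_left.2 fun z hz hzQ => ?_
    obtain ⟨Q, hQ, hzQ⟩ := mem_iUnion₂.1 hzQ
    exact complComponents_subset (hfin.mem_toFinset.1 hQ) hzQ hz.2

/-- The functional `S(f)` bounds `∫ (|f'| - 1)²` over large discs up to an error `O(1 / R)`. -/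
theorem energy_inequality (H : NormalizedConformal Ω f F a)
    (hsq : ∀ Q ∈ complComponents Ω, IsAxisSquare Q) (hfin : (complComponents Ω).Finite) :
    (complComponents (f '' Ω)).Finite ∧ ∃ C r : ℝ, 0 < r ∧ ∀ R, r ≤ R →
      0 ≤ squareFunctional a (f '' Ω) + C / R ∧
      ∫⁻ z in Metric.closedBall 0 R ∩ finitePart Ω, ENNReal.ofReal ((‖deriv F z‖ - 1) ^ 2) ≤
        ENNReal.ofReal (squareFunctional a (f '' Ω) + C / R) := by
  classical
  obtain ⟨σ, hσ, hlim⟩ := H.exists_componentMap hsq hfin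
  have hfinD : (complComponents (f '' Ω)).Finite := hσ.image_eq ▸ hfin.image σ
  refine ⟨hfinD, ?_⟩
  obtain ⟨C₁, r₁, hr₁, hlen⟩ := H.length_inequality hsq hfin hσ.mapsTo hlim
  obtain ⟨C₂, r₂, hC₂, hr₂, harea⟩ := H.area_inequality hfinD
  obtain ⟨r₃, hr₃, hvol⟩ := H.volume_add_sum_le hsq hfin
  have htoF : hfinD.toFinset = hfin.toFinset.image σ := by
    ext K
    simp [← hσ.image_eq]
  have hinj : InjOn σ hfin.toFinset := by
    simpa using hσ.injOn
  set V := verticalVariation with hV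
  set s := hfin.toFinset with hs
  have hfun : squareFunctional a (f '' Ω) =
      2 * Real.pi * a.re + ∑ Q ∈ s, (V (σ Q) ^ 2 - planarArea (σ Q)) := by
    rw [squareFunctional, finsum_mem_eq_finite_toFinset_sum _ hfinD, htoF,
      Finset.sum_image hinj]
  refine ⟨C₂ + 2 * C₁, max r₁ (max r₂ r₃), by positivity, fun R hR => ?_⟩
  simp only [max_le_iff] at hR
  have hlen := hlen R hR.1
  have harea := harea R hR.2.1
  have hvol := hvol R hR.2.2
  rw [htoF, Finset.sum_image hinj] at harea
  set B := Metric.closedBall 0 R ∩ finitePart Ω with hB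
  have hmeas : Measurable fun z => ‖deriv F z‖ := (measurable_deriv F).norm
  set J := ∫⁻ z in B, ENNReal.ofReal ((‖deriv F z‖ - 1) ^ 2) with hJ
  set m := ∫⁻ z in B, ‖deriv F z‖ₑ with hm
  set e := ∫⁻ z in B, ‖deriv F z‖ₑ ^ 2 with he
  -- the identity `(x - 1)² + 2x = x² + 1`, integrated in a form that needs no integrability
  have hid : J + 2 * m = e + volume B := by
    rw [hJ, hm, he, ← lintegral_const_mul _ (measurable_deriv F).enorm,
      ← lintegral_add_left (((hmeas.sub_const 1).pow_const 2).ennreal_ofReal),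
      ← setLIntegral_one, ← lintegral_add_right _ measurable_const]
    refine lintegral_congr fun z => ?_
    rw [← ofReal_norm, ← ENNReal.ofReal_pow (norm_nonneg _),
      show (2 : ENNReal) = ENNReal.ofReal 2 by simp, ← ENNReal.ofReal_mul zero_le_two,
      ← ENNReal.ofReal_add (sq_nonneg _) (by positivity), ← ENNReal.ofReal_one,
      ← ENNReal.ofReal_add (by positivity) zero_le_one]
    congr 1
    ring
  have hVnn : ∀ Q ∈ s, 0 ≤ V Q := fun Q hQ => by
    obtain ⟨-, -, h, -⟩ := (hsq Q (hfin.mem_toFinset.1 hQ)).exists_eq_reProdIm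
    exact h
  have hσVnn : ∀ Q ∈ s, 0 ≤ V (σ Q) := fun Q hQ => by
    have hQ' := hσ.mapsTo (hfin.mem_toFinset.1 hQ)
    exact verticalVariation_nonneg (isCompact_finitePart
      (complComponents_isClosed H.isOpen_image hQ')
      (complComponents_infty_notMem H.infty_mem_image hQ'))
  have hAnn : ∀ Q ∈ s, 0 ≤ planarArea (σ Q) := fun Q _ => measureReal_nonneg
  rw [← ENNReal.ofReal_sum_of_nonneg fun Q hQ => mul_nonneg (hσVnn Q hQ) (hVnn Q hQ)] at hlen
  rw [← ENNReal.ofReal_sum_of_nonneg hAnn] at harea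
  rw [← ENNReal.ofReal_sum_of_nonneg fun Q _ => sq_nonneg _] at hvol
  set A := ∑ Q ∈ s, planarArea (σ Q) with hA
  set W := ∑ Q ∈ s, V (σ Q) * V Q with hW
  set Z := ∑ Q ∈ s, V Q ^ 2 with hZ
  set L := Real.pi * R ^ 2 - Real.pi * a.re - C₁ / R with hL
  have hA0 : 0 ≤ A := Finset.sum_nonneg hAnn
  have hW0 : 0 ≤ W := Finset.sum_nonneg fun Q hQ => mul_nonneg (hσVnn Q hQ) (hVnn Q hQ)
  have hZ0 : 0 ≤ Z := Finset.sum_nonneg fun Q _ => sq_nonneg _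
  have hfinA : e ≠ ⊤ := ne_top_of_le_ne_top ENNReal.ofReal_ne_top (le_self_add.trans harea)
  have hfinB : volume B ≠ ⊤ := ne_top_of_le_ne_top ENNReal.ofReal_ne_top (le_self_add.trans hvol)
  have hfinJm : J + 2 * m ≠ ⊤ := hid ▸ ENNReal.add_ne_top.2 ⟨hfinA, hfinB⟩
  have hfinJ : J ≠ ⊤ := (ENNReal.add_ne_top.1 hfinJm).1
  have hfinm2 : 2 * m ≠ ⊤ := (ENNReal.add_ne_top.1 hfinJm).2
  have hfinm : m ≠ ⊤ := ne_top_of_le_ne_top hfinm2 (le_mul_of_one_le_left' (by norm_num))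
  have rid : J.toReal + 2 * m.toReal = e.toReal + (volume B).toReal := by
    have := congrArg ENNReal.toReal hid
    rwa [ENNReal.toReal_add hfinJ hfinm2, ENNReal.toReal_add hfinA hfinB, ENNReal.toReal_mul,
      ENNReal.toReal_ofNat] at this
  have hreal : ∀ (x : ENNReal) (y z : ℝ), x ≠ ⊤ → 0 ≤ y → 0 ≤ z →
      x + ENNReal.ofReal y ≤ ENNReal.ofReal z → x.toReal + y ≤ z := by
    intro x y z hx hy hz h
    have := ENNReal.toReal_mono ENNReal.ofReal_ne_top h
    rwa [ENNReal.toReal_add hx ENNReal.ofReal_ne_top, ENNReal.toReal_ofReal hy,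
      ENNReal.toReal_ofReal hz] at this
  have hR0 : 0 < R := hr₁.trans_le hR.1
  have hpi := Real.pi_pos
  have rarea := hreal e A _ hfinA hA0 (by positivity) harea
  have rvol := hreal (volume B) Z _ hfinB hZ0 (by positivity) hvol
  have rlen : L ≤ m.toReal + W := by
    have := ENNReal.toReal_mono (ENNReal.add_ne_top.2 ⟨hfinm, ENNReal.ofReal_ne_top⟩) hlen
    rw [ENNReal.toReal_add hfinm ENNReal.ofReal_ne_top, ENNReal.toReal_ofReal hW0] at this
    rw [ENNReal.toReal_ofReal'] at this
    exact (le_max_left _ _).trans this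
  have hsquare : 2 * W - A - Z ≤ ∑ Q ∈ s, (V (σ Q) ^ 2 - planarArea (σ Q)) := by
    have h1 : ∑ Q ∈ s, (V (σ Q) ^ 2 - planarArea (σ Q)) - (2 * W - A - Z) =
        ∑ Q ∈ s, (V (σ Q) - V Q) ^ 2 := by
      rw [hA, hW, hZ, Finset.mul_sum, ← Finset.sum_sub_distrib, ← Finset.sum_sub_distrib,
        ← Finset.sum_sub_distrib]
      exact Finset.sum_congr rfl fun Q _ => by ring
    have h2 : 0 ≤ ∑ Q ∈ s, (V (σ Q) - V Q) ^ 2 := Finset.sum_nonneg fun Q _ => sq_nonneg _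
    linarith
  have hJle : J.toReal ≤ squareFunctional a (f '' Ω) + (C₂ + 2 * C₁) / R := by
    have h1 : (C₂ + 2 * C₁) / R = C₂ / R + 2 * (C₁ / R) := by ring
    rw [hfun, h1]
    linarith
  exact ⟨ENNReal.toReal_nonneg.trans hJle, (ENNReal.le_ofReal_iff_toReal_le hfinJ
    (ENNReal.toReal_nonneg.trans hJle)).2 hJle⟩

theorem squareFunctional_nonneg (H : NormalizedConformal Ω f F a)
    (hsq : ∀ Q ∈ complComponents Ω, IsAxisSquare Q) (hfin : (complComponents Ω).Finite) :
    0 ≤ squareFunctional a (f '' Ω) := by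
  obtain ⟨-, C, r, hr, h⟩ := H.energy_inequality hsq hfin
  have hlim : Tendsto (fun R : ℝ => squareFunctional a (f '' Ω) + C / R) atTop
      (𝓝 (squareFunctional a (f '' Ω) + 0)) :=
    tendsto_const_nhds.add (tendsto_const_nhds.div_atTop tendsto_id)
  rw [add_zero] at hlim
  exact ge_of_tendsto hlim ((eventually_ge_atTop r).mono fun R hR => (h R hR).1)

/-- If `F' = c` is constant, the normalization at `∞` forces `F` to be the identity. -/
theorem eqOn_id_of_deriv_eq (H : NormalizedConformal Ω f F a) {c : ℂ}
    (hc : ∀ z ∈ finitePart Ω, deriv F z = c) : EqOn f id Ω := by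
  have hU := isOpen_finitePart H.isOpen
  have hUc := isPreconnected_finitePart H.isOpen H.isPreconnected H.infty_mem
  have hd : DifferentiableOn ℂ (fun z => F z - c * z) (finitePart Ω) := fun z hz =>
    ((H.analyticAt z hz).differentiableAt.sub (by fun_prop)).differentiableWithinAt
  obtain ⟨d, hd⟩ := hU.exists_is_const_of_deriv_eq_zero hUc hd fun z hz => by
    have h1 : HasDerivAt (fun z => F z - c * z) (deriv F z - c * 1) z :=
      (H.analyticAt z hz).differentiableAt.hasDerivAt.sub ((hasDerivAt_id z).const_mul c)
    rw [h1.deriv, hc z hz]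
    simp
  obtain ⟨C, r, h⟩ := H.exists_asymp_mem
  obtain ⟨B, hB, hBF⟩ := exists_norm_sub_le_of_asymp fun z hz => (h.2.2 z hz).2
  have hkey : ∀ t : ℝ, max r 1 ≤ t → ‖(c - 1) * t + d‖ ≤ B / t := by
    intro t ht
    have ht0 : 0 ≤ t := zero_le_one.trans ((le_max_right _ _).trans ht)
    have hn : ‖(t : ℂ)‖ = t := by rw [Complex.norm_real, Real.norm_of_nonneg ht0]
    have h1 := hBF t (by rw [hn]; exact ht)
    have h2 := hd t (h.2.2 t (by rw [hn]; exact (le_max_left _ _).trans ht)).1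
    rw [hn] at h1
    rwa [show (c - 1) * t + d = F t - t by rw [← h2]; ring]
  have hBt : Tendsto (fun t : ℝ => B / t) atTop (𝓝 0) :=
    tendsto_const_nhds.div_atTop tendsto_id
  have h0 : Tendsto (fun t : ℝ => (c - 1) * t + d) atTop (𝓝 0) :=
    squeeze_zero_norm' ((eventually_ge_atTop _).mono hkey) hBt
  have hc1 : c - 1 = 0 := by
    have h1 : Tendsto (fun t : ℝ => ((c - 1) * t + d) - ((c - 1) * (t + 1 : ℝ) + d)) atTop
        (𝓝 (0 - 0)) := h0.sub (h0.comp (tendsto_atTop_add_const_right _ 1 tendsto_id))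
    have h2 : (fun t : ℝ => ((c - 1) * t + d) - ((c - 1) * (t + 1 : ℝ) + d)) =
        fun _ => -(c - 1) := by
      funext t; push_cast; ring
    rw [h2, sub_zero] at h1
    exact neg_eq_zero.1 (tendsto_nhds_unique tendsto_const_nhds h1)
  have hd0 : d = 0 := by
    simp only [hc1, zero_mul, zero_add] at h0
    exact tendsto_nhds_unique tendsto_const_nhds h0
  intro p hp
  induction p using OnePoint.rec with
  | infty => exact H.map_infty
  | coe z =>
    have h1 := hd z hp
    rw [H.coe_eq z hp, id, OnePoint.coe_eq_coe]
    rw [hd0, sub_eq_zero.1 hc1, one_mul, sub_eq_zero] at h1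
    exact h1

theorem eqOn_id_of_squareFunctional_eq_zero (H : NormalizedConformal Ω f F a)
    (hsq : ∀ Q ∈ complComponents Ω, IsAxisSquare Q) (hfin : (complComponents Ω).Finite)
    (h0 : squareFunctional a (f '' Ω) = 0) : EqOn f id Ω := by
  obtain ⟨-, C, r, hr, h⟩ := H.energy_inequality hsq hfin
  have hU := isOpen_finitePart H.isOpen
  have hUc := isPreconnected_finitePart H.isOpen H.isPreconnected H.infty_mem
  have hlim : Tendsto (fun R : ℝ => ENNReal.ofReal (squareFunctional a (f '' Ω) + C / R)) atTop
      (𝓝 (ENNReal.ofReal (squareFunctional a (f '' Ω) + 0))) :=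
    ENNReal.tendsto_ofReal (tendsto_const_nhds.add (tendsto_const_nhds.div_atTop tendsto_id))
  rw [add_zero, h0, ENNReal.ofReal_zero] at hlim
  have hJ : ∀ R, ∫⁻ z in Metric.closedBall 0 R ∩ finitePart Ω,
      ENNReal.ofReal ((‖deriv F z‖ - 1) ^ 2) = 0 := by
    intro R
    refine le_antisymm (ge_of_tendsto hlim ?_) bot_le
    filter_upwards [eventually_ge_atTop r, eventually_ge_atTop R] with T hT hRT
    rw [← h0]
    refine le_trans (lintegral_mono_set ?_) (h T hT).2
    exact inter_subset_inter_left _ (Metric.closedBall_subset_closedBall hRT)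
  have hnorm : ∀ z ∈ finitePart Ω, ‖deriv F z‖ = 1 := by
    intro z hz
    have h1 := hJ (‖z‖ + 1)
    rw [lintegral_eq_zero_iff (((measurable_deriv F).norm.sub_const 1).pow_const
      2).ennreal_ofReal] at h1
    have hcont : ContinuousOn (fun z => ENNReal.ofReal ((‖deriv F z‖ - 1) ^ 2))
        (Metric.ball 0 (‖z‖ + 1) ∩ finitePart Ω) := by
      intro w hw
      refine ContinuousAt.continuousWithinAt ?_
      exact ENNReal.continuous_ofReal.continuousAt.comp
        (((H.analyticAt w hw.2).deriv.continuousAt.norm.sub_const 1).pow 2)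
    have h2 := Measure.eqOn_open_of_ae_eq (ae_restrict_of_ae_restrict_of_subset
      (inter_subset_inter_left _ Metric.ball_subset_closedBall) h1)
      (Metric.isOpen_ball.inter hU) hcont continuousOn_const
      (show z ∈ Metric.ball 0 (‖z‖ + 1) ∩ finitePart Ω from
        ⟨by rw [mem_ball_zero_iff]; linarith, hz⟩)
    have h3 : (‖deriv F z‖ - 1) ^ 2 ≤ 0 := ENNReal.ofReal_eq_zero.1 h2
    have h4 : ‖deriv F z‖ - 1 = 0 := pow_eq_zero_iff two_ne_zero |>.1 (le_antisymm h3 (sq_nonneg _))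
    linarith
  obtain ⟨C', r', -, -, hr'⟩ := H.exists_asymp_mem
  have hz₀ : ((|r'| : ℝ) : ℂ) ∈ finitePart Ω := (hr' _ (by
    rw [Complex.norm_real, Real.norm_of_nonneg (abs_nonneg _)]; exact le_abs_self _)).1
  have hconst := Complex.eqOn_of_isPreconnected_of_isMaxOn_norm hUc hU
    (fun z hz => (H.analyticAt z hz).deriv.differentiableAt.differentiableWithinAt) hz₀
    (fun z hz => show ‖deriv F z‖ ≤ ‖deriv F _‖ by rw [hnorm z hz, hnorm _ hz₀])
  exact H.eqOn_id_of_deriv_eq hconst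

end NormalizedConformal

theorem IsSquareDomain.squareFunctional_eq {D : Set (OnePoint ℂ)} (hD : IsSquareDomain D)
    (a : ℂ) : squareFunctional a D = 2 * Real.pi * a.re := by
  rw [squareFunctional, finsum_mem_congr rfl fun K hK => by
    rw [(hD.squares K hK).planarArea_eq, sub_self], finsum_mem_zero, add_zero]

theorem NormalizedConformal.eq_zero_of_eqOn_id {Ω : Set (OnePoint ℂ)}
    {f : OnePoint ℂ → OnePoint ℂ} {F : ℂ → ℂ} {a : ℂ} (H : NormalizedConformal Ω f F a)
    (hid : EqOn f id Ω) : a = 0 := by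
  obtain ⟨C, r, hC, hr, h⟩ := H.exists_asymp_mem
  have hkey : ∀ t : ℝ, r ≤ t → ‖a‖ ≤ C / t := by
    intro t ht
    have ht0 : 0 < t := by linarith
    have hn : ‖(t : ℂ)‖ = t := by rw [Complex.norm_real, Real.norm_of_nonneg ht0.le]
    obtain ⟨h1, h2⟩ := h t (by rw [hn]; exact ht)
    have h3 : F t = t := OnePoint.coe_injective ((H.coe_eq t h1).symm.trans (hid h1))
    rw [h3, sub_self, zero_sub, norm_neg, norm_div, hn, div_le_iff₀ ht0] at h2
    refine h2.trans_eq ?_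
    field_simp
  have hlim : Tendsto (fun t : ℝ => C / t) atTop (𝓝 0) :=
    tendsto_const_nhds.div_atTop tendsto_id
  exact norm_le_zero_iff.1 (ge_of_tendsto hlim ((eventually_ge_atTop r).mono hkey))

theorem sphereHolomorphicAt_id (p : OnePoint ℂ) : SphereHolomorphicAt id p := by
  refine ⟨continuousAt_id, ?_⟩
  have : (fun w => sphereCoord (id p) (id (sphereParam p w))) = id := by
    funext w
    induction p using OnePoint.rec with
    | coe z => rfl
    | infty =>
      show sphereCoord OnePoint.infty
        (if w = 0 then OnePoint.infty else ((w⁻¹ : ℂ) : OnePoint ℂ)) = w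
      by_cases hw : w = 0
      · rw [if_pos hw, hw]; rfl
      · rw [if_neg hw]
        exact inv_inv w
  rw [this]
  exact analyticAt_id

theorem SphereHolomorphicAt.congr {f g : OnePoint ℂ → OnePoint ℂ} {p : OnePoint ℂ}
    (hf : SphereHolomorphicAt f p) (h : g =ᶠ[𝓝 p] f) : SphereHolomorphicAt g p := by
  have hparam : Tendsto (sphereParam p) (𝓝 (sphereCoord p p)) (𝓝 p) := by
    induction p using OnePoint.rec with
    | coe z => exact OnePoint.continuous_coe.continuousAt
    | infty => exact map_sphereParam_infty.le
  refine ⟨hf.1.congr h.symm, hf.2.congr ?_⟩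
  filter_upwards [hparam.eventually h] with w hw
  rw [hw, h.eq_of_nhds]

theorem hasNormalizedExpansion_of_eqOn_id {Ω : Set (OnePoint ℂ)} (hΩ : Ω ∈ 𝓝 OnePoint.infty)
    {f : OnePoint ℂ → OnePoint ℂ} (hid : EqOn f id Ω) : HasNormalizedExpansion f 0 := by
  refine ⟨0, analyticAt_const, ?_⟩
  have := OnePoint.tendsto_coe_infty (X := ℂ)
  rw [coclosedCompact_eq_cocompact] at this
  filter_upwards [this hΩ] with z hz
  rw [hid hz]
  simp

theorem proposition2 (Ω : Set (OnePoint ℂ)) (hΩ : IsSquareDomain Ω)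
    (hfin : (complComponents Ω).Finite) :
    (∀ (f : OnePoint ℂ → OnePoint ℂ) (a₁ : ℂ),
      IsConformalMapOn f Ω → HasNormalizedExpansion f a₁ →
        (complComponents (f '' Ω)).Finite ∧
        0 ≤ squareFunctional a₁ (f '' Ω) ∧
        (squareFunctional a₁ (f '' Ω) = 0 ↔ EqOn f id Ω)) ∧
    (∀ f : OnePoint ℂ → OnePoint ℂ,
      (IsConformalMapOn f Ω ∧ (∃ a₁ : ℂ, HasNormalizedExpansion f a₁) ∧
        IsSquareDomain (f '' Ω)) ↔ EqOn f id Ω) := by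
  have hnhds := hΩ.isOpen.mem_nhds hΩ.infty_mem
  have himage : ∀ f : OnePoint ℂ → OnePoint ℂ, EqOn f id Ω → f '' Ω = Ω := fun f hid => by
    rw [hid.image_eq, image_id]
  refine ⟨fun f a hf ha => ?_, fun f => ⟨?_, fun hid => ⟨⟨fun p hp => ?_, ?_⟩, ?_, ?_⟩⟩⟩
  · obtain ⟨F, H⟩ := NormalizedConformal.exists_of_isConformalMapOn hΩ.isOpen
      hΩ.isConnected.isPreconnected hΩ.infty_mem hf ha
    refine ⟨(H.energy_inequality hΩ.squares hfin).1, H.squareFunctional_nonneg hΩ.squares hfin,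
      H.eqOn_id_of_squareFunctional_eq_zero hΩ.squares hfin, fun hid => ?_⟩
    rw [himage f hid, hΩ.squareFunctional_eq, H.eq_zero_of_eqOn_id hid]
    simp
  · rintro ⟨hf, ⟨a, ha⟩, hD⟩
    obtain ⟨F, H⟩ := NormalizedConformal.exists_of_isConformalMapOn hΩ.isOpen
      hΩ.isConnected.isPreconnected hΩ.infty_mem hf ha
    obtain ⟨G, H'⟩ := H.symm
    have h1 := H.squareFunctional_nonneg hΩ.squares hfin
    have h2 := H'.squareFunctional_nonneg hD.squares (H.energy_inequality hΩ.squares hfin).1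
    rw [H.injOn.leftInvOn_invFunOn.image_image, hΩ.squareFunctional_eq, Complex.neg_re] at h2
    refine H.eqOn_id_of_squareFunctional_eq_zero hΩ.squares hfin (le_antisymm ?_ h1)
    rw [hD.squareFunctional_eq]
    linarith
  · refine (sphereHolomorphicAt_id p).congr ?_
    filter_upwards [hΩ.isOpen.mem_nhds hp] with q hq using hid hq
  · exact (injOn_id Ω).congr hid.symm
  · exact ⟨0, hasNormalizedExpansion_of_eqOn_id hnhds hid⟩
  · rw [himage f hid]
    exact hΩ
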